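/- Let $H_3(\mathbb R)$ be the Heisenberg group of real upper unitriangular $3\times 3$ matrices, $H_3(\mathbb Z)$ the lattice of its integer matrices, and $\mathfrak h_3(\mathbb R)$ its Lie algebra of strictly upper triangular real $3\times3$ matrices. Let $P(\mathfrak h_3(\mathbb R))$ be the set of lines through $0$ in $\mathfrak h_3(\mathbb R)$, on which $H_3(\mathbb R)$ acts through the adjoint action $g\cdot v=gvg^{-1}$; for a line $\theta$ put $\exp(\theta)=\{\exp(v): v\in\theta\}$. For $t\in\mathbb R$ let $\theta_t$ be the line through $\begin{pmatrix}0&1&t\\0&0&0\\0&0&0\end{pmatrix}$ and let $\theta_\infty$ be the line through $\begin{pmatrix}0&0&1\\0&0&0\\0&0&0\end{pmatrix}$. Let $\mathrm{dist}$ be a right-invariant metric on $H_3(\mathbb R)$ compatible with its topology. A measure preserving action $T=(T_\gamma)$ of $H_3(\mathbb Z)$ on a $\sigma$-finite standard measure space $(X,\mu)$ is called *recurrent along* $\theta\in P(\mathfrak h_3(\mathbb R))$ if for every $\epsilon>0$ and every measurable $A\subset X$ with $\mu(A)>0$ there are $\gamma\in H_3(\mathbb Z)\setminus\{1\}$ and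 $g\in\exp(\theta)$ with $\mathrm{dist}(\gamma,g)<\epsilon$ and $\mu(A\cap T_\gamma A)>0$; it is called *evenly recurrent along* $\theta$ if it is recurrent along every line in the $H_3(\mathbb R)$-orbit of $\theta$. Let $\mathcal R(T)$ and $\mathcal{ER}(T)$ be the sets of lines along which $T$ is recurrent and evenly recurrent, respectively. The action $T$ has *rank one* if there are measurable sets $B_n\subset X$ with $0<\mu(B_n)<\infty$ and a (left) Følner sequence $(F_n)$ of finite subsets of $H_3(\mathbb Z)$ such that for every $n$ the sets $T_fB_n$, $f\in F_n$, are pairwise disjoint, and for every measurable $A$ with $\mu(A)<\infty$ there are $S_n\subset F_n$ with $\mu\big(A\,\triangle\,\bigcup_{f\in S_n}T_fB_n\big)\to 0$ as $n\to\infty$. **Theorem.** There are a standard Borel space $X$ with a $\sigma$-finite measure $\mu$, $\mu(X)=\infty$, and a free (that is, $T_\gamma x\ne x$ for all $x\in X$ and $\gamma\ne1$), rank-one, $\mu$-preserving action $T$ of $H_3(\mathbb Z)$ on $(X,\mu)$ such that, for every choice of $\mathrm{dist}$, $$\mathcal R(T)=\{\theta_l: l\in\mathbb Z\}\cup\{\theta_\infty\}.$$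 Moreover $\mathcal{ER}(T)=\{\theta_\infty\}$, and hence $\mathcal R(T)\neq\mathcal{ER}(T)$. -/

import Mathlib

open MeasureTheory Filter Topology
open scoped Pointwise symmDiff ENNReal LinearAlgebra.Projectivization

noncomputable section

namespace Heisenberg

/-- The real matrix with `x`, `y` next to the diagonal, `z` in the corner, and constant diagonal
`e`. For `e = 1` this is an element of `H₃(ℝ)`, for `e = 0` an element of its Lie algebra. -/
abbrev upper (e x y z : ℝ) : Matrix (Fin 3) (Fin 3) ℝ :=
  !![e, x, z; 0, e, y; 0, 0, e]

theorem upper_mul (e x y z e' x' y' z' : ℝ) :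
    upper e x y z * upper e' x' y' z' =
      upper (e * e') (e * x' + x * e') (e * y' + y * e') (e * z' + x * y' + z * e') := by
  ext i j
  fin_cases i <;> fin_cases j <;> simp [upper, Matrix.mul_apply, Fin.sum_univ_three]

theorem adjugate_upper (x y z : ℝ) :
    (upper 1 x y z).adjugate = upper 1 (-x) (-y) (x * y - z) := by
  rw [upper, Matrix.adjugate_fin_three_of]
  ext i j
  fin_cases i <;> fin_cases j <;> simp [upper]

/-- The Heisenberg group `H₃(ℝ)` of upper unitriangular real `3 × 3` matrices. -/
def H3R : Subgroup (Matrix.SpecialLinearGroup (Fin 3) ℝ) where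
  carrier := {g | ∃ x y z : ℝ, (g : Matrix (Fin 3) (Fin 3) ℝ) = upper 1 x y z}
  one_mem' := ⟨0, 0, 0, by
    ext i j
    fin_cases i <;> fin_cases j <;> simp [upper]⟩
  mul_mem' := by
    rintro g h ⟨x, y, z, hg⟩ ⟨x', y', z', hh⟩
    refine ⟨x' + x, y' + y, z' + x * y' + z, ?_⟩
    rw [Matrix.SpecialLinearGroup.coe_mul, hg, hh, upper_mul]
    simp
  inv_mem' := by
    rintro g ⟨x, y, z, hg⟩
    refine ⟨-x, -y, x * y - z, ?_⟩
    rw [Matrix.SpecialLinearGroup.coe_inv, hg, adjugate_upper]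

/-- The underlying matrix of an element of `H₃(ℝ)`. -/
def H3R.mat (g : H3R) : Matrix (Fin 3) (Fin 3) ℝ := (g : Matrix.SpecialLinearGroup (Fin 3) ℝ)

theorem H3R.mat_one : H3R.mat 1 = 1 := by simp [H3R.mat]

theorem H3R.mat_mul (g h : H3R) : H3R.mat (g * h) = H3R.mat g * H3R.mat h := by simp [H3R.mat]

theorem H3R.mat_inv (g : H3R) : H3R.mat g⁻¹ = (H3R.mat g).adjugate := by
  simp [H3R.mat, Matrix.SpecialLinearGroup.coe_inv]

/-- The lattice `H₃(ℤ)` of integer matrices in `H₃(ℝ)`. -/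
def H3Z : Subgroup H3R where
  carrier := {g | ∃ n₁ n₂ n₃ : ℤ, H3R.mat g = upper 1 n₁ n₂ n₃}
  one_mem' := ⟨0, 0, 0, by
    rw [H3R.mat_one]
    ext i j
    fin_cases i <;> fin_cases j <;> simp [upper]⟩
  mul_mem' := by
    rintro g h ⟨x, y, z, hg⟩ ⟨x', y', z', hh⟩
    refine ⟨x' + x, y' + y, z' + x * y' + z, ?_⟩
    rw [H3R.mat_mul, hg, hh, upper_mul]
    simp
  inv_mem' := by
    rintro g ⟨x, y, z, hg⟩
    refine ⟨-x, -y, x * y - z, ?_⟩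
    rw [H3R.mat_inv, hg, adjugate_upper]
    simp

/-- The Lie algebra `𝔥₃(ℝ)` of strictly upper triangular real `3 × 3` matrices (as a
vector space; it is closed under the commutator bracket). -/
def h3 : Submodule ℝ (Matrix (Fin 3) (Fin 3) ℝ) where
  carrier := {v | ∃ x y z : ℝ, v = upper 0 x y z}
  zero_mem' := ⟨0, 0, 0, by
    ext i j
    fin_cases i <;> fin_cases j <;> simp [upper]⟩
  add_mem' := by
    rintro v w ⟨x, y, z, rfl⟩ ⟨x', y', z', rfl⟩
    refine ⟨x + x', y + y', z + z', ?_⟩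
    ext i j
    fin_cases i <;> fin_cases j <;> simp [upper]
  smul_mem' := by
    rintro c v ⟨x, y, z, rfl⟩
    refine ⟨c * x, c * y, c * z, ?_⟩
    ext i j
    fin_cases i <;> fin_cases j <;> simp [upper]

theorem conj_mem_h3 (g : H3R) (v : h3) :
    H3R.mat g * (v : Matrix (Fin 3) (Fin 3) ℝ) * H3R.mat g⁻¹ ∈ h3 := by
  obtain ⟨x, y, z, hg⟩ := g.2
  obtain ⟨α, β, γ, hv⟩ := v.2
  have hg' : H3R.mat g = upper 1 x y z := hg
  refine ⟨α, β, γ + x * β - y * α, ?_⟩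
  rw [H3R.mat_inv, hg', hv, adjugate_upper, upper_mul, upper_mul]
  ext i j
  fin_cases i <;> fin_cases j <;> simp [upper]
  ring

/-- The adjoint action `g · v = g v g⁻¹` of `H₃(ℝ)` on its Lie algebra. -/
instance adjointAction : DistribMulAction H3R h3 where
  smul g v := ⟨H3R.mat g * (v : Matrix (Fin 3) (Fin 3) ℝ) * H3R.mat g⁻¹, conj_mem_h3 g v⟩
  one_smul v := Subtype.ext <| by
    change H3R.mat 1 * (v : Matrix (Fin 3) (Fin 3) ℝ) * H3R.mat 1⁻¹ = v
    simp [H3R.mat_one]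
  mul_smul g h v := Subtype.ext <| by
    change H3R.mat (g * h) * (v : Matrix (Fin 3) (Fin 3) ℝ) * H3R.mat (g * h)⁻¹ =
      H3R.mat g * (H3R.mat h * (v : Matrix (Fin 3) (Fin 3) ℝ) * H3R.mat h⁻¹) * H3R.mat g⁻¹
    rw [mul_inv_rev, H3R.mat_mul, H3R.mat_mul]
    simp only [mul_assoc]
  smul_zero g := Subtype.ext <| by
    change H3R.mat g * (0 : Matrix (Fin 3) (Fin 3) ℝ) * H3R.mat g⁻¹ = 0
    simp
  smul_add g v w := Subtype.ext <| by
    change H3R.mat g * ((v : Matrix (Fin 3) (Fin 3) ℝ) + w) * H3R.mat g⁻¹ =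
      H3R.mat g * (v : Matrix (Fin 3) (Fin 3) ℝ) * H3R.mat g⁻¹ +
        H3R.mat g * (w : Matrix (Fin 3) (Fin 3) ℝ) * H3R.mat g⁻¹
    rw [mul_add, add_mul]

instance : SMulCommClass H3R ℝ h3 where
  smul_comm g c v := Subtype.ext <| by
    change H3R.mat g * (c • (v : Matrix (Fin 3) (Fin 3) ℝ)) * H3R.mat g⁻¹ =
      c • (H3R.mat g * (v : Matrix (Fin 3) (Fin 3) ℝ) * H3R.mat g⁻¹)
    rw [mul_smul_comm, smul_mul_assoc]

/-- The one-parameter subgroup `exp(θ) = {exp(v) | v ∈ θ}` of `H₃(ℝ)` given by a line `θ` in the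
Lie algebra. The group `H₃(ℝ)` acts on the set `ℙ ℝ h3` of these lines through `adjointAction`. -/
def expLine (θ : ℙ ℝ h3) : Set H3R :=
  {g | ∃ v ∈ θ.submodule, H3R.mat g = NormedSpace.exp (v : Matrix (Fin 3) (Fin 3) ℝ)}

/-- The line through the matrix with entries `1`, `t` in positions `(1,2)`, `(1,3)`. -/
def thetaLine (t : ℝ) : ℙ ℝ h3 :=
  Projectivization.mk ℝ (⟨upper 0 1 0 t, 1, 0, t, rfl⟩ : h3) fun h => by
    simpa [upper] using congrFun (congrFun (congrArg Subtype.val h) 0) 1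

/-- The line through the matrix with entry `1` in position `(1,3)`. -/
def thetaInf : ℙ ℝ h3 :=
  Projectivization.mk ℝ (⟨upper 0 0 0 1, 0, 0, 1, rfl⟩ : h3) fun h => by
    simpa [upper] using congrFun (congrFun (congrArg Subtype.val h) 0) 2

/-- `m` is a right-invariant metric on `H₃(ℝ)` compatible with the topology of `H₃(ℝ)` as a space
of matrices. -/
structure IsRightInvariantMetric (m : MetricSpace H3R) : Prop where
  compatible : m.toUniformSpace.toTopologicalSpace =
    TopologicalSpace.induced H3R.mat inferInstance
  dist_mul_right : ∀ g h k : H3R, m.dist (g * k) (h * k) = m.dist g h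

section Recurrence

variable {X : Type*} [MeasurableSpace X] [MulAction H3Z X]

/-- Recurrence of an action of `H₃(ℤ)` along a line `θ`. -/
def IsRecurrentAlong (m : MetricSpace H3R) (μ : Measure X) (θ : ℙ ℝ h3) : Prop :=
  ∀ ε : ℝ, 0 < ε → ∀ A : Set X, MeasurableSet A → 0 < μ A →
    ∃ γ : H3Z, γ ≠ 1 ∧ ∃ g ∈ expLine θ, m.dist (γ : H3R) g < ε ∧ 0 < μ (A ∩ γ • A)

/-- Even recurrence: recurrence along every line in the adjoint orbit of `θ`. -/
def IsEvenlyRecurrentAlong (m : MetricSpace H3R) (μ : Measure X) (θ : ℙ ℝ h3) : Prop :=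
  ∀ θ' ∈ MulAction.orbit H3R θ, IsRecurrentAlong m μ θ'

/-- The set of recurrent lines. -/
def recurrentLines (m : MetricSpace H3R) (μ : Measure X) : Set (ℙ ℝ h3) :=
  {θ | IsRecurrentAlong m μ θ}

/-- The set of evenly recurrent lines. -/
def evenlyRecurrentLines (m : MetricSpace H3R) (μ : Measure X) : Set (ℙ ℝ h3) :=
  {θ | IsEvenlyRecurrentAlong m μ θ}

end Recurrence

end Heisenberg

/-- A (left) Følner sequence of finite subsets of a discrete group, the size of a set being its
cardinality. -/
def IsFolnerSequence {Γ : Type*} [Group Γ] (F : ℕ → Finset Γ) : Prop :=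
  letI : MeasurableSpace Γ := ⊤
  IsFoelner Γ (Measure.count : Measure Γ) atTop fun n => (F n : Set Γ)

/-- Rank one: there are Rokhlin towers with base `B n` and levels indexed by `F n`, where `F` is a
Følner sequence, such that every measurable set of finite measure is approximated by unions of
levels of the `n`-th tower, as `n → ∞`. -/
def IsRankOne (Γ : Type*) [Group Γ] {X : Type*} [MeasurableSpace X] [MulAction Γ X]
    (μ : Measure X) : Prop :=
  ∃ (B : ℕ → Set X) (F : ℕ → Finset Γ),
    IsFolnerSequence F ∧
    (∀ n, MeasurableSet (B n) ∧ 0 < μ (B n) ∧ μ (B n) < ∞) ∧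
    (∀ n, (F n : Set Γ).PairwiseDisjoint fun f => f • B n) ∧
    ∀ A : Set X, MeasurableSet A → μ A < ∞ →
      ∃ S : ℕ → Finset Γ, (∀ n, S n ⊆ F n) ∧
        Tendsto (fun n => μ (A ∆ ⋃ f ∈ S n, f • B n)) atTop (𝓝 0)

end

open Heisenberg

noncomputable section

namespace Heisenberg

/-! The lattice acts by left multiplication on the Heisenberg group over the `2`-adic integers,
which is a free action. Inside the plane with middle coordinate `0`, take the random points `∑ scale
i * digit i * direction i`, where the digits are fair coin tosses, the scales are rapidly growing
powers of two, and the directions run infinitely often through `(0, 1)` and every `(1, l)`, `l ∈ ℤ`.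

A lattice element carrying one such point to another determines the difference of their digit
sequences (`digit_sub_eq_of_smul_point_eq`), so it acts on these points by flipping digits. Flips
preserve coin tossing, hence the law of the random point extends to an invariant measure on its
saturation (`translatesSup_apply`, `restrict_map_pointMeasure_le`). This measure is infinite because
moving the middle coordinate gives infinitely many disjoint copies. Points with first `n` digits
zero form the base of a tower whose shape is a box of side `scale n`. Cylinders are unions of
levels, which gives rank one (`pairwiseDisjoint_box`, `exists_eq_union_levels`,
`isFolnerSequence_box`).

Flipping a single late digit `m` is the action of `singleStep m`, and it returns part of any set of
positive measure to itself (`exists_measure_inter_conj_pos`). Conjugation by `g`, needed on the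
translate of the points by `g`, fixes vertical steps and shifts the slope `l` by an integer. The set
of integral slopes absorbs this shift, which gives recurrence along `θ_∞` and every `θ_l`.
Conversely, a nontrivial return to a tower base is dominated by its last step, in one of the chosen
directions (`exists_leading_step`), so it stays far from `exp θ_t` when `t` is not an integer. Lines
leaving the plane are excluded because returns have middle coordinate `0`. Finally, all the `θ_t`
form one adjoint orbit, while `θ_∞` is fixed; so only `θ_∞` is evenly recurrent. -/

/-! ### Coordinates on the group and the lattice. -/

theorem H3R.mat_injective : Function.Injective H3R.mat :=
  Subtype.val_injective.comp Subtype.val_injective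

theorem H3R.mat_eq (g : H3R) :
    H3R.mat g = upper 1 (H3R.mat g 0 1) (H3R.mat g 1 2) (H3R.mat g 0 2) := by
  obtain ⟨x, y, z, h⟩ := g.2
  have h' : H3R.mat g = upper 1 x y z := h
  rw [h']
  simp [upper]

/-- The element of `H₃(ℝ)` with given coordinates. -/
def H3R.of (x y z : ℝ) : H3R :=
  ⟨⟨upper 1 x y z, by simp [upper, Matrix.det_fin_three]⟩, x, y, z, rfl⟩

@[simp] theorem H3R.mat_of (x y z : ℝ) : H3R.mat (H3R.of x y z) = upper 1 x y z := rfl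

namespace H3Z

/-- The entry in position `(1,2)`. -/
def cx (γ : H3Z) : ℤ := γ.2.choose

/-- The entry in position `(2,3)`. -/
def cy (γ : H3Z) : ℤ := γ.2.choose_spec.choose

/-- The entry in position `(1,3)`. -/
def cz (γ : H3Z) : ℤ := γ.2.choose_spec.choose_spec.choose

theorem mat_eq (γ : H3Z) : H3R.mat γ = upper 1 (cx γ) (cy γ) (cz γ) :=
  γ.2.choose_spec.choose_spec.choose_spec

/-- The element of `H₃(ℤ)` with given coordinates. -/
def of (a b c : ℤ) : H3Z := ⟨H3R.of a b c, a, b, c, rfl⟩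

theorem mat_of (a b c : ℤ) : H3R.mat (of a b c) = upper 1 a b c := rfl

theorem upper_one_inj {x y z x' y' z' : ℝ} (h : upper 1 x y z = upper 1 x' y' z') :
    x = x' ∧ y = y' ∧ z = z' := by
  refine ⟨?_, ?_, ?_⟩
  · simpa [upper] using congrFun (congrFun h 0) 1
  · simpa [upper] using congrFun (congrFun h 1) 2
  · simpa [upper] using congrFun (congrFun h 0) 2

theorem coords_of_mat {γ : H3Z} {a b c : ℤ} (h : H3R.mat γ = upper 1 a b c) :
    cx γ = a ∧ cy γ = b ∧ cz γ = c := by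
  have := upper_one_inj ((mat_eq γ).symm.trans h)
  exact_mod_cast this

@[simp] theorem cx_of (a b c : ℤ) : cx (of a b c) = a := (coords_of_mat (mat_of a b c)).1
@[simp] theorem cy_of (a b c : ℤ) : cy (of a b c) = b := (coords_of_mat (mat_of a b c)).2.1
@[simp] theorem cz_of (a b c : ℤ) : cz (of a b c) = c := (coords_of_mat (mat_of a b c)).2.2

theorem coords_ext {γ δ : H3Z} (hx : cx γ = cx δ) (hy : cy γ = cy δ) (hz : cz γ = cz δ) :
    γ = δ := by
  apply Subtype.ext
  apply H3R.mat_injective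
  rw [mat_eq, mat_eq, hx, hy, hz]

theorem coords_mul (γ δ : H3Z) :
    cx (γ * δ) = cx γ + cx δ ∧ cy (γ * δ) = cy γ + cy δ ∧
      cz (γ * δ) = cz γ + cz δ + cx γ * cy δ := by
  apply coords_of_mat
  rw [Subgroup.coe_mul, H3R.mat_mul, mat_eq, mat_eq, upper_mul]
  congr 1 <;> push_cast <;> ring_nf

@[simp] theorem cx_mul (γ δ : H3Z) : cx (γ * δ) = cx γ + cx δ := (coords_mul γ δ).1
@[simp] theorem cy_mul (γ δ : H3Z) : cy (γ * δ) = cy γ + cy δ := (coords_mul γ δ).2.1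
@[simp] theorem cz_mul (γ δ : H3Z) : cz (γ * δ) = cz γ + cz δ + cx γ * cy δ := (coords_mul γ δ).2.2

theorem one_eq_of : (1 : H3Z) = of 0 0 0 := by
  apply Subtype.ext
  apply H3R.mat_injective
  rw [mat_of, Subgroup.coe_one, H3R.mat_one]
  ext i j
  fin_cases i <;> fin_cases j <;> simp [upper]

@[simp] theorem cx_one : cx (1 : H3Z) = 0 := by rw [one_eq_of, cx_of]
@[simp] theorem cy_one : cy (1 : H3Z) = 0 := by rw [one_eq_of, cy_of]
@[simp] theorem cz_one : cz (1 : H3Z) = 0 := by rw [one_eq_of, cz_of]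

@[simp] theorem cx_inv (γ : H3Z) : cx γ⁻¹ = -cx γ := by
  have := cx_mul γ⁻¹ γ
  simp at this
  linarith

@[simp] theorem cy_inv (γ : H3Z) : cy γ⁻¹ = -cy γ := by
  have := cy_mul γ⁻¹ γ
  simp at this
  linarith

@[simp] theorem cz_inv (γ : H3Z) : cz γ⁻¹ = -cz γ + cx γ * cy γ := by
  have := cz_mul γ⁻¹ γ
  simp at this
  linarith

/-- Elements of `H₃(ℤ)` are triples of integers. -/
def equivInt : H3Z ≃ ℤ × ℤ × ℤ where
  toFun γ := (cx γ, cy γ, cz γ)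
  invFun p := of p.1 p.2.1 p.2.2
  left_inv γ := coords_ext (by simp) (by simp) (by simp)
  right_inv p := by simp

instance : Countable H3Z := equivInt.injective.countable

end H3Z

/-! ### The exponential map, the adjoint action and the classification of lines. -/

theorem exp_upper_zero (x y z : ℝ) :
    NormedSpace.exp (upper 0 x y z) = upper 1 x y (z + x * y / 2) := by
  have h2 : upper 0 x y z ^ 2 = upper 0 0 0 (x * y) := by
    rw [pow_two, upper_mul]
    simp
  have h3 : upper 0 x y z ^ 3 = 0 := by
    rw [pow_succ, h2, upper_mul]
    ext i j
    fin_cases i <;> fin_cases j <;> simp [upper]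
  rw [NormedSpace.exp_eq_tsum ℝ]
  dsimp only
  rw [tsum_eq_sum (s := Finset.range 3)]
  · simp only [Finset.sum_range_succ, Finset.sum_range_zero, h2]
    ext i j
    fin_cases i <;> fin_cases j <;> (simp [upper]; try ring)
  · intro n hn
    have hn : 3 ≤ n := by simpa using hn
    rw [← Nat.sub_add_cancel hn, pow_add, h3, mul_zero, smul_zero]

theorem upper_zero_injective {x y z x' y' z' : ℝ} (h : upper 0 x y z = upper 0 x' y' z') :
    x = x' ∧ y = y' ∧ z = z' := by
  refine ⟨?_, ?_, ?_⟩
  · simpa [upper] using congrFun (congrFun h 0) 1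
  · simpa [upper] using congrFun (congrFun h 1) 2
  · simpa [upper] using congrFun (congrFun h 0) 2

/-- The element of the Lie algebra with given coordinates. -/
def h3.of (x y z : ℝ) : h3 := ⟨upper 0 x y z, x, y, z, rfl⟩

theorem h3.of_surjective (v : h3) : ∃ x y z, v = h3.of x y z := by
  obtain ⟨x, y, z, h⟩ := v.2
  exact ⟨x, y, z, Subtype.ext h⟩

theorem h3.smul_of (s x y z : ℝ) : s • h3.of x y z = h3.of (s * x) (s * y) (s * z) := by
  apply Subtype.ext
  ext i j
  fin_cases i <;> fin_cases j <;> simp [upper, h3.of]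

theorem h3.of_inj {x y z x' y' z' : ℝ} (h : h3.of x y z = h3.of x' y' z') :
    x = x' ∧ y = y' ∧ z = z' :=
  upper_zero_injective (congrArg Subtype.val h)

theorem adjoint_smul_of (x y z a b c : ℝ) :
    H3R.of x y z • h3.of a b c = h3.of a b (c + x * b - y * a) := by
  apply Subtype.ext
  change H3R.mat (H3R.of x y z) * upper 0 a b c * H3R.mat (H3R.of x y z)⁻¹ = _
  rw [H3R.mat_inv, H3R.mat_of, adjugate_upper, upper_mul, upper_mul]
  ext i j
  fin_cases i <;> fin_cases j <;> simp [upper, h3.of]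
  ring

theorem mem_expLine_mk {a b c : ℝ} (h : h3.of a b c ≠ 0) (g : H3R) :
    g ∈ expLine (Projectivization.mk ℝ (h3.of a b c) h) ↔
      ∃ s : ℝ, H3R.mat g = upper 1 (s * a) (s * b) (s * c + s * a * (s * b) / 2) := by
  constructor
  · rintro ⟨v, hv, hg⟩
    rw [Projectivization.submodule_mk, Submodule.mem_span_singleton] at hv
    obtain ⟨s, rfl⟩ := hv
    refine ⟨s, ?_⟩
    rw [hg, h3.smul_of]
    exact exp_upper_zero _ _ _
  · rintro ⟨s, hs⟩
    refine ⟨s • h3.of a b c, ?_, ?_⟩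
    · rw [Projectivization.submodule_mk, Submodule.mem_span_singleton]
      exact ⟨s, rfl⟩
    · rw [hs, h3.smul_of]
      exact (exp_upper_zero _ _ _).symm

/-- Closeness in a right-invariant metric forces entrywise closeness of `γ g⁻¹` to `1`. -/
theorem IsRightInvariantMetric.exists_entries_lt {m : MetricSpace H3R}
    (hm : IsRightInvariantMetric m) {η : ℝ} (hη : 0 < η) :
    ∃ ε > 0, ∀ γ g : H3R, m.dist γ g < ε → ∃ a b c : ℝ, |a| < η ∧ |b| < η ∧ |c| < η ∧
      H3R.mat γ = upper 1 a b c * H3R.mat g := by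
  have hnhds : {h : H3R | |H3R.mat h 0 1| < η ∧ |H3R.mat h 1 2| < η ∧ |H3R.mat h 0 2| < η} ∈
      @nhds H3R m.toUniformSpace.toTopologicalSpace 1 := by
    rw [hm.compatible, nhds_induced]
    refine ⟨{A | |A 0 1| < η ∧ |A 1 2| < η ∧ |A 0 2| < η}, ?_, fun h hh => hh⟩
    apply IsOpen.mem_nhds
    · have hc (i j : Fin 3) : Continuous fun A : Matrix (Fin 3) (Fin 3) ℝ => |A i j| :=
        (continuous_id.matrix_elem i j).abs
      exact (isOpen_lt (hc 0 1) continuous_const).inter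
        ((isOpen_lt (hc 1 2) continuous_const).inter (isOpen_lt (hc 0 2) continuous_const))
    · simp [H3R.mat_one, hη]
  let _ := m
  obtain ⟨ε, hε, hball⟩ := Metric.mem_nhds_iff.1 hnhds
  refine ⟨ε, hε, fun γ g hγ => ?_⟩
  have h1 : γ * g⁻¹ ∈ Metric.ball (1 : H3R) ε := by
    rw [Metric.mem_ball]
    have := hm.dist_mul_right γ g g⁻¹
    rw [mul_inv_cancel] at this
    exact this.trans_lt hγ
  obtain ⟨ha, hb, hc⟩ := hball h1
  refine ⟨_, _, _, ha, hb, hc, ?_⟩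
  rw [← H3R.mat_eq, ← H3R.mat_mul, inv_mul_cancel_right]

theorem thetaLine_eq (t : ℝ) : ∃ h, thetaLine t = Projectivization.mk ℝ (h3.of 1 0 t) h :=
  ⟨_, rfl⟩

theorem thetaInf_eq : ∃ h, thetaInf = Projectivization.mk ℝ (h3.of 0 0 1) h := ⟨_, rfl⟩

/-- A line is transverse to the plane of horizontal lines, or one of the `θ_t`, or `θ_∞`. -/
theorem line_cases (θ : ℙ ℝ h3) :
    (∃ a c, ∃ h : h3.of a 1 c ≠ 0, θ = Projectivization.mk ℝ (h3.of a 1 c) h) ∨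
      (∃ t, θ = thetaLine t) ∨ θ = thetaInf := by
  induction θ using Projectivization.ind with
  | h v hv =>
    obtain ⟨a, b, c, rfl⟩ := h3.of_surjective v
    by_cases hb : b = 0
    · subst hb
      right
      by_cases ha : a = 0
      · subst ha
        right
        obtain ⟨h, e⟩ := thetaInf_eq
        rw [e, Projectivization.mk_eq_mk_iff']
        exact ⟨c, by rw [h3.smul_of]; simp⟩
      · left
        refine ⟨c / a, ?_⟩
        obtain ⟨h, e⟩ := thetaLine_eq (c / a)
        rw [e, Projectivization.mk_eq_mk_iff']
        exact ⟨a, by rw [h3.smul_of, mul_div_cancel₀ _ ha]; simp⟩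
    · left
      refine ⟨a / b, c / b, ?_, ?_⟩
      · intro h
        have : h3.of (a / b) 1 (c / b) = h3.of 0 0 0 := h.trans (by
          apply Subtype.ext
          ext i j
          fin_cases i <;> fin_cases j <;> simp [upper, h3.of])
        exact one_ne_zero (h3.of_inj this).2.1
      · rw [Projectivization.mk_eq_mk_iff']
        exact ⟨b, by rw [h3.smul_of, mul_div_cancel₀ _ hb, mul_div_cancel₀ _ hb, mul_one]⟩

theorem smul_thetaInf (g : H3R) : g • thetaInf = thetaInf := by
  obtain ⟨h, e⟩ := thetaInf_eq
  obtain ⟨x, y, z, rfl⟩ : ∃ x y z, g = H3R.of x y z :=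
    ⟨_, _, _, H3R.mat_injective (H3R.mat_eq g)⟩
  rw [e, Projectivization.smul_mk, Projectivization.mk_eq_mk_iff']
  exact ⟨1, by rw [one_smul, adjoint_smul_of]; simp⟩

/-- Conjugation by an element with middle coordinate `y` lowers the slope by `y`. Over `ℝ` this
reaches nonintegral slopes, which defeats even recurrence; over `ℤ` it only permutes the integral
ones. -/
theorem thetaLine_mem_orbit (s t : ℝ) : thetaLine t ∈ MulAction.orbit H3R (thetaLine s) := by
  refine ⟨H3R.of 0 (s - t) 0, ?_⟩
  obtain ⟨h, e⟩ := thetaLine_eq s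
  obtain ⟨h', e'⟩ := thetaLine_eq t
  change H3R.of 0 (s - t) 0 • thetaLine s = _
  rw [e, e', Projectivization.smul_mk, Projectivization.mk_eq_mk_iff']
  exact ⟨1, by rw [one_smul, adjoint_smul_of]; congr 1; ring⟩

/-! ### Scales and `2`-adic series with slowly growing coefficients. -/

/-- Half of the `i`-th scale. -/
def halfScale (i : ℕ) : ℤ := 2 ^ (i * (i + 2))

/-- The rapidly growing sequence of scales. -/
def scale (i : ℕ) : ℤ := 2 ^ (i * (i + 2) + 1)

theorem scale_eq (i : ℕ) : scale i = 2 * halfScale i := by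
  rw [scale, halfScale, pow_succ, mul_comm]

theorem scale_succ (i : ℕ) : scale (i + 1) = 2 ^ (2 * i + 3) * scale i := by
  rw [scale, scale, ← pow_add]
  congr 1
  ring

theorem halfScale_pos (i : ℕ) : 0 < halfScale i := by unfold halfScale; positivity

theorem scale_pos (i : ℕ) : 0 < scale i := by unfold scale; positivity

theorem lt_halfScale (i : ℕ) : (i : ℤ) < halfScale i := by
  have h : i < 2 ^ (i * (i + 2)) :=
    (Nat.lt_two_pow_self).trans_le (Nat.pow_le_pow_right two_pos (by nlinarith))
  unfold halfScale
  exact_mod_cast h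

theorem scale_dvd {i j : ℕ} (h : i ≤ j) : scale i ∣ scale j :=
  pow_dvd_pow _ (by nlinarith)

/-- The sum of `(i + 1) * scale i` over `i < n`, which bounds the partial sums. -/
def partialBound (n : ℕ) : ℤ := ∑ i ∈ Finset.range n, (i + 1) * scale i

theorem partialBound_nonneg (n : ℕ) : 0 ≤ partialBound n :=
  Finset.sum_nonneg fun i _ => mul_nonneg (by positivity) (scale_pos i).le

theorem sq_le_two_pow (n : ℕ) : ((n : ℤ) + 2) * (n + 2) ≤ 2 ^ (2 * n + 2) := by
  have h : n + 2 ≤ 2 ^ (n + 1) := Nat.lt_two_pow_self (n := n + 1)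
  have h2 : (n + 2) * (n + 2) ≤ 2 ^ (n + 1) * 2 ^ (n + 1) := Nat.mul_le_mul h h
  rw [← pow_add] at h2
  have : n + 1 + (n + 1) = 2 * n + 2 := by ring
  rw [this] at h2
  exact_mod_cast h2

/-- The ratio of consecutive scales grows like `4 ^ n` and beats the quadratic factor in the
induction. The extra factor `n + 1` makes all earlier terms together negligible against any fixed
multiple of the current scale. -/
theorem mul_partialBound_le (n : ℕ) : ((n : ℤ) + 1) * partialBound n ≤ halfScale n := by
  induction n with
  | zero => simpa [partialBound] using (halfScale_pos 0).le
  | succ n ih =>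
    have h1 : partialBound (n + 1) = partialBound n + (n + 1) * scale n :=
      Finset.sum_range_succ _ _
    have h2 : halfScale (n + 1) = 2 ^ (2 * n + 2) * scale n := by
      have := scale_succ n
      rw [scale_eq, pow_succ] at this
      linarith
    have h3 := mul_le_mul_of_nonneg_right (sq_le_two_pow n) (scale_pos n).le
    have h4 : partialBound n ≤ scale n := by
      have := partialBound_nonneg n
      have := scale_eq n
      have := halfScale_pos n
      nlinarith
    rw [h1, h2]
    push_cast
    nlinarith

/-- Integers of small size which are divisible by a scale vanish. -/
theorem eq_zero_of_scale_dvd {n : ℕ} {k : ℤ} (h : scale n ∣ k) (hk : |k| < scale n) : k = 0 :=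
  Int.eq_zero_of_abs_lt_dvd h hk

/-- The partial sums of the series with coefficients `a`. -/
def partialSum (a : ℕ → ℤ) (n : ℕ) : ℤ := ∑ i ∈ Finset.range n, scale i * a i

theorem partialSum_succ (a : ℕ → ℤ) (n : ℕ) :
    partialSum a (n + 1) = partialSum a n + scale n * a n := Finset.sum_range_succ _ _

theorem abs_partialSum_le {a : ℕ → ℤ} (h : ∀ i : ℕ, |a i| ≤ i + 1) (n : ℕ) :
    |partialSum a n| ≤ partialBound n := by
  refine (Finset.abs_sum_le_sum_abs _ _).trans (Finset.sum_le_sum fun i _ => ?_)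
  rw [abs_mul, abs_of_pos (scale_pos i), mul_comm]
  exact mul_le_mul_of_nonneg_right (h i) (scale_pos i).le

theorem scale_dvd_int_iff {n : ℕ} {k : ℤ} :
    ((scale n : ℤ) : ℤ_[2]) ∣ k ↔ scale n ∣ k := by
  have := PadicInt.pow_p_dvd_int_iff (p := 2) (n * (n + 2) + 1) k
  unfold scale
  push_cast at this ⊢
  exact this

theorem norm_term_le (a : ℤ) (i : ℕ) : ‖((scale i * a : ℤ) : ℤ_[2])‖ ≤ (1 / 2) ^ i := by
  rw [Int.cast_mul, norm_mul]
  have h : ‖((scale i : ℤ) : ℤ_[2])‖ ≤ (1 / 2) ^ i := by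
    have h2 : ‖(2 : ℤ_[2])‖ = 1 / 2 := by
      have := PadicInt.norm_p (p := 2)
      simpa using this
    rw [scale, Int.cast_pow, norm_pow, Int.cast_ofNat, h2]
    exact pow_le_pow_of_le_one (by norm_num) (by norm_num) (by nlinarith)
  exact (mul_le_of_le_one_right (norm_nonneg _) (PadicInt.norm_le_one _)).trans h

theorem summable_half : Summable fun i : ℕ => (1 / 2 : ℝ) ^ i :=
  summable_geometric_of_lt_one (by norm_num) (by norm_num)

theorem summable_term (a : ℕ → ℤ) : Summable fun i => ((scale i * a i : ℤ) : ℤ_[2]) :=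
  Summable.of_norm_bounded summable_half fun i => norm_term_le (a i) i

/-- The `2`-adic integer `∑ scale i * a i`. -/
def series (a : ℕ → ℤ) : ℤ_[2] := ∑' i, ((scale i * a i : ℤ) : ℤ_[2])

theorem series_add (a b : ℕ → ℤ) : series (a + b) = series a + series b := by
  rw [series, series, series, ← (summable_term a).tsum_add (summable_term b)]
  congr 1
  ext1 i
  rw [Pi.add_apply]
  push_cast
  ring

theorem series_sub (a b : ℕ → ℤ) : series (a - b) = series a - series b := by
  rw [eq_sub_iff_add_eq, ← series_add, sub_add_cancel]

theorem series_single (m : ℕ) (k : ℤ) : series (Pi.single m k) = ((scale m * k : ℤ) : ℤ_[2]) := by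
  rw [series, tsum_eq_single m]
  · simp
  · intro i hi
    simp [Pi.single_eq_of_ne hi]

theorem dvd_series_sub_partialSum (a : ℕ → ℤ) (n : ℕ) :
    ((scale n : ℤ) : ℤ_[2]) ∣ series a - (partialSum a n : ℤ) := by
  have h1 : series a - (partialSum a n : ℤ) =
      ∑' i, ((scale (i + n) * a (i + n) : ℤ) : ℤ_[2]) := by
    rw [series, ← (summable_term a).sum_add_tsum_nat_add n, partialSum]
    push_cast
    ring
  have h2 : ((scale n : ℤ) : ℤ_[2]) = (2 : ℤ_[2]) ^ (n * (n + 2) + 1) := by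
    simp [scale]
  rw [h1, h2]
  have := PadicInt.norm_le_pow_iff_mem_span_pow (p := 2)
    (∑' i, ((scale (i + n) * a (i + n) : ℤ) : ℤ_[2])) (n * (n + 2) + 1)
  rw [Ideal.mem_span_singleton] at this
  refine this.1 (IsUltrametricDist.norm_tsum_le_of_forall_le fun i => ?_)
  refine (PadicInt.norm_int_le_pow_iff_dvd (p := 2)).2 ?_
  have h3 : scale n ∣ scale (i + n) * a (i + n) := (scale_dvd (by omega)).mul_right _
  rw [scale] at h3
  exact_mod_cast h3

theorem continuous_series {T : Type*} [TopologicalSpace T] {a : T → ℕ → ℤ}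
    (h : ∀ i, Continuous fun t => a t i) : Continuous fun t => series (a t) := by
  unfold series
  refine continuous_tsum (fun i => ?_) summable_half fun i t => norm_term_le (a t i) i
  exact (continuous_of_discreteTopology (f := fun k : ℤ => ((scale i * k : ℤ) : ℤ_[2]))).comp (h i)

/-- If the sum of a series with slowly growing coefficients is an integer, then it is
eventually equal to the partial sums. -/
theorem eventually_eq_partialSum {a : ℕ → ℤ} (ha : ∀ i : ℕ, |a i| ≤ i + 1) {k : ℤ}
    (h : series a = k) : ∀ᶠ n in atTop, k = partialSum a n := by
  filter_upwards [eventually_ge_atTop k.natAbs] with n hn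
  have h1 : scale n ∣ k - partialSum a n := by
    rw [← scale_dvd_int_iff, Int.cast_sub, ← h]
    exact dvd_series_sub_partialSum a n
  have h2 : |k| ≤ n := by
    rw [Int.abs_eq_natAbs]
    exact_mod_cast hn
  have h3 := abs_partialSum_le ha n
  have h4 := mul_partialBound_le n
  have h5 := partialBound_nonneg n
  have h6 := lt_halfScale n
  have h7 := scale_eq n
  -- Both numbers are bounded by `halfScale n`, the first strictly, and they agree modulo `scale n`.
  have h8 : |k - partialSum a n| < scale n := by
    have := abs_sub k (partialSum a n)
    nlinarith
  exact sub_eq_zero.1 (eq_zero_of_scale_dvd h1 h8)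

/-! ### Directions of the steps and uniqueness of digit differences. -/

/-- The directions of the successive steps: `(0, 1)` or `(1, l)` for an integer `l`. -/
def direction (i : ℕ) : ℤ × ℤ :=
  if Even i.unpair.2 then (0, 1)
  else (1, (i.unpair.1.unpair.1 : ℤ) - i.unpair.1.unpair.2)

theorem direction_cases (i : ℕ) : direction i = (0, 1) ∨ ∃ l : ℤ, direction i = (1, l) := by
  unfold direction
  split_ifs
  · exact .inl rfl
  · exact .inr ⟨_, rfl⟩

theorem abs_direction_le (i : ℕ) : |(direction i).1| ≤ i + 1 ∧ |(direction i).2| ≤ i + 1 := by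
  have h1 := Nat.unpair_left_le i
  have h2 := Nat.unpair_left_le i.unpair.1
  have h3 := Nat.unpair_right_le i.unpair.1
  unfold direction
  split_ifs
  · simp
    omega
  · simp only [abs_le]
    omega

theorem exists_direction_inf (N : ℕ) : ∃ m ≥ N, direction m = (0, 1) := by
  refine ⟨Nat.pair 0 (2 * N), ?_, ?_⟩
  · have := Nat.right_le_pair 0 (2 * N)
    omega
  · simp [direction]

theorem exists_direction (l : ℤ) (N : ℕ) : ∃ m ≥ N, direction m = (1, l) := by
  refine ⟨Nat.pair (Nat.pair l.toNat (-l).toNat) (2 * N + 1), ?_, ?_⟩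
  · have := Nat.right_le_pair (Nat.pair l.toNat (-l).toNat) (2 * N + 1)
    omega
  · have : ¬ Even (2 * N + 1) := by simp
    simp [direction]

/-- First coordinates of the steps with coefficients `η`. -/
def xPart (η : ℕ → ℤ) (i : ℕ) : ℤ := η i * (direction i).1

/-- Second coordinates of the steps with coefficients `η`. -/
def zPart (η : ℕ → ℤ) (i : ℕ) : ℤ := η i * (direction i).2

theorem xPart_sub (η θ : ℕ → ℤ) : xPart (η - θ) = xPart η - xPart θ := by
  ext i; simp [xPart, sub_mul]

theorem zPart_sub (η θ : ℕ → ℤ) : zPart (η - θ) = zPart η - zPart θ := by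
  ext i; simp [zPart, sub_mul]

theorem abs_xPart_le {η : ℕ → ℤ} (h : ∀ i, |η i| ≤ 1) (i : ℕ) : |xPart η i| ≤ i + 1 := by
  rw [xPart, abs_mul]
  exact (mul_le_of_le_one_left (abs_nonneg _) (h i)).trans (abs_direction_le i).1

theorem abs_zPart_le {η : ℕ → ℤ} (h : ∀ i, |η i| ≤ 1) (i : ℕ) : |zPart η i| ≤ i + 1 := by
  rw [zPart, abs_mul]
  exact (mul_le_of_le_one_left (abs_nonneg _) (h i)).trans (abs_direction_le i).2

/-- Coefficients bounded by `2` are determined by the sums of the two series. -/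
theorem eq_zero_of_series_eq_zero {η : ℕ → ℤ} (hη : ∀ i, |η i| ≤ 2)
    (hx : series (xPart η) = 0) (hz : series (zPart η) = 0) : η = 0 := by
  ext i
  induction i using Nat.strong_induction_on with
  | _ i ih =>
    have key (a : ℕ → ℤ) (ha : ∀ j < i, a j = 0) (h : series a = 0) :
        scale (i + 1) ∣ scale i * a i := by
      have h1 : partialSum a (i + 1) = scale i * a i := by
        rw [partialSum_succ, partialSum, Finset.sum_eq_zero, zero_add]
        intro j hj
        rw [ha j (Finset.mem_range.1 hj), mul_zero]
      have h2 := dvd_series_sub_partialSum a (i + 1)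
      rw [h, zero_sub, dvd_neg, h1] at h2
      exact scale_dvd_int_iff.1 h2
    -- Every direction has a coordinate equal to `1`, and that coordinate's series isolates `η i`.
    have hdvd : scale (i + 1) ∣ scale i * η i := by
      rcases direction_cases i with h | ⟨l, h⟩
      · simpa [zPart, h] using key (zPart η) (fun j hj => by simp [zPart, ih j hj]) hz
      · simpa [xPart, h] using key (xPart η) (fun j hj => by simp [xPart, ih j hj]) hx
    -- Consecutive scales differ by a factor divisible by `8`, too large for a nonzero coefficient
    -- of size at most `2`.
    have h8 : (8 : ℤ) * scale i ∣ scale (i + 1) := by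
      rw [scale_succ, pow_add]
      exact ⟨2 ^ (2 * i), by ring⟩
    have h9 := h8.trans hdvd
    rw [mul_comm] at h9
    have h10 : (8 : ℤ) ∣ η i := (mul_dvd_mul_iff_left (scale_pos i).ne').1 h9
    exact Int.eq_zero_of_abs_lt_dvd h10 (by have := hη i; omega)

end Heisenberg
end

noncomputable section

/-! ### Extending a measure to an invariant one. -/

section InvariantExtension

variable {G X : Type*} [Group G] [MeasurableSpace X] [MulAction G X]

/-- The smallest measure above all translates of a given measure. -/
def translatesSup (G : Type*) {X : Type*} [Group G] [MeasurableSpace X] [MulAction G X]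
    (κ : Measure X) : Measure X := ⨆ g : G, κ.map (g • ·)

theorem map_le_translatesSup (κ : Measure X) (g : G) : κ.map (g • ·) ≤ translatesSup G κ :=
  le_iSup (fun g : G => κ.map (g • ·)) g

/-- The supremum of the translates extends `κ` when the translates are compatible with `κ`. -/
theorem translatesSup_apply {κ : Measure X} {K : Set X} (hK : MeasurableSet K)
    (h : ∀ g : G, (κ.map (g • ·)).restrict K ≤ κ) {A : Set X}
    (hA : A ⊆ K) : translatesSup G κ A = κ A := by
  apply le_antisymm
  · have h1 : translatesSup G κ ≤ κ + (⊤ : Measure X).restrict Kᶜ := by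
      refine iSup_le fun g => ?_
      rw [← Measure.restrict_add_restrict_compl (μ := κ.map (g • ·)) hK]
      exact add_le_add (h g) (Measure.restrict_mono subset_rfl le_top)
    refine (h1 A).trans ?_
    rw [Measure.add_apply]
    have h2 : (⊤ : Measure X).restrict Kᶜ A = 0 := by
      refine measure_mono_null hA ?_
      rw [Measure.restrict_apply hK, Set.inter_compl_self, measure_empty]
    rw [h2, add_zero]
  · have h1 := map_le_translatesSup κ (1 : G)
    simp only [one_smul, Measure.map_id'] at h1
    exact h1 A

variable [MeasurableConstSMul G X]

theorem le_map_translatesSup (κ : Measure X) (g : G) :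
    translatesSup G κ ≤ (translatesSup G κ).map (g • ·) := by
  refine iSup_le fun h => ?_
  have h1 : κ.map (h • ·) = (κ.map ((g⁻¹ * h) • ·)).map (g • ·) := by
    rw [Measure.map_map (measurable_const_smul g) (measurable_const_smul _)]
    congr 1
    ext x
    simp [mul_smul]
  rw [h1]
  exact Measure.map_mono (map_le_translatesSup κ _) (measurable_const_smul g)

/-- Translation only permutes the family, which gives one inequality for every group element;
pushing forward the inequality for `g⁻¹` gives the reverse one for `g`. -/
theorem measurePreserving_translatesSup (κ : Measure X) (g : G) :
    MeasurePreserving (g • ·) (translatesSup G κ) (translatesSup G κ) := by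
  refine ⟨measurable_const_smul g, le_antisymm ?_ (le_map_translatesSup κ g)⟩
  have h := Measure.map_mono (le_map_translatesSup κ g⁻¹) (measurable_const_smul g)
  rw [Measure.map_map (measurable_const_smul g) (measurable_const_smul _)] at h
  have h1 : ((g • ·) ∘ (g⁻¹ • ·) : X → X) = id := by
    ext x
    simp
  rwa [h1, Measure.map_id] at h

theorem translatesSup_compl_eq_zero [Countable G] {κ : Measure X} {K : Set X}
    (hK : MeasurableSet K) (h : κ Kᶜ = 0) : translatesSup G κ (⋃ g : G, g • K)ᶜ = 0 := by
  have hU : MeasurableSet (⋃ g : G, g • K) := MeasurableSet.iUnion fun g => hK.const_smul g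
  have h1 : translatesSup G κ ≤ (⊤ : Measure X).restrict (⋃ g : G, g • K) := by
    refine iSup_le fun g => ?_
    rw [← Measure.restrict_add_restrict_compl (μ := κ.map (g • ·)) hU]
    have h2 : (κ.map (g • ·)).restrict (⋃ g : G, g • K)ᶜ = 0 := by
      rw [Measure.restrict_eq_zero, Measure.map_apply (measurable_const_smul g) hU.compl]
      have h3 : (g • ·) ⁻¹' (⋃ g : G, g • K)ᶜ ⊆ Kᶜ := fun x hx hxK =>
        hx (Set.mem_iUnion.2 ⟨g, Set.smul_mem_smul_set hxK⟩)
      exact measure_mono_null h3 h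
    rw [h2, add_zero]
    exact Measure.restrict_mono subset_rfl le_top
  refine le_antisymm ((h1 _).trans ?_) zero_le
  rw [Measure.restrict_apply hU.compl, Set.compl_inter_self, measure_empty]

end InvariantExtension

/-! ### The `2`-adic Heisenberg space and the lattice action. -/

namespace Heisenberg

/-- The space of coordinate triples of the Heisenberg group over the `2`-adic integers. -/
def Space : Type := ℤ_[2] × ℤ_[2] × ℤ_[2]

namespace Space

instance : TopologicalSpace Space := inferInstanceAs (TopologicalSpace (ℤ_[2] × ℤ_[2] × ℤ_[2]))

instance : T2Space Space := inferInstanceAs (T2Space (ℤ_[2] × ℤ_[2] × ℤ_[2]))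

instance : PolishSpace Space := by
  have : PolishSpace ℤ_[2] := inferInstance
  exact inferInstanceAs (PolishSpace (ℤ_[2] × ℤ_[2] × ℤ_[2]))

instance : MeasurableSpace Space := borel Space

instance : BorelSpace Space := ⟨rfl⟩

/-- Left multiplication by integer matrices. -/
instance : MulAction H3Z Space where
  smul γ p := ((H3Z.cx γ : ℤ_[2]) + p.1, (H3Z.cy γ : ℤ_[2]) + p.2.1,
    (H3Z.cz γ : ℤ_[2]) + p.2.2 + H3Z.cx γ * p.2.1)
  one_smul p := by
    change (((H3Z.cx 1 : ℤ) : ℤ_[2]) + p.1, ((H3Z.cy 1 : ℤ) : ℤ_[2]) + p.2.1,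
      ((H3Z.cz 1 : ℤ) : ℤ_[2]) + p.2.2 + (H3Z.cx 1 : ℤ) * p.2.1) = p
    simp only [H3Z.cx_one, H3Z.cy_one, H3Z.cz_one, Int.cast_zero, zero_add, zero_mul, add_zero]
    rfl
  mul_smul γ δ p := by
    change (((H3Z.cx (γ * δ) : ℤ) : ℤ_[2]) + p.1, ((H3Z.cy (γ * δ) : ℤ) : ℤ_[2]) + p.2.1,
      ((H3Z.cz (γ * δ) : ℤ) : ℤ_[2]) + p.2.2 + (H3Z.cx (γ * δ) : ℤ) * p.2.1) =
      ((H3Z.cx γ : ℤ_[2]) + (H3Z.cx δ + p.1), (H3Z.cy γ : ℤ_[2]) + (H3Z.cy δ + p.2.1),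
      (H3Z.cz γ : ℤ_[2]) + (H3Z.cz δ + p.2.2 + H3Z.cx δ * p.2.1)
        + H3Z.cx γ * (H3Z.cy δ + p.2.1))
    simp only [H3Z.cx_mul, H3Z.cy_mul, H3Z.cz_mul]
    push_cast
    ext1
    · ring
    · ext1
      · ring
      · ring

/-- The point with given coordinates. -/
def mk (x y z : ℤ_[2]) : Space := (x, y, z)

theorem mk_surjective (p : Space) : ∃ x y z, p = mk x y z := ⟨p.1, p.2.1, p.2.2, rfl⟩

theorem smul_mk (γ : H3Z) (x y z : ℤ_[2]) : γ • mk x y z =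
    mk ((H3Z.cx γ : ℤ_[2]) + x) ((H3Z.cy γ : ℤ_[2]) + y)
      ((H3Z.cz γ : ℤ_[2]) + z + H3Z.cx γ * y) :=
  rfl

theorem mk_inj {x y z x' y' z' : ℤ_[2]} (h : mk x y z = mk x' y' z') :
    x = x' ∧ y = y' ∧ z = z' := by
  have h' : ((x, y, z) : ℤ_[2] × ℤ_[2] × ℤ_[2]) = (x', y', z') := h
  simpa using h'

instance : MeasurableConstSMul H3Z Space where
  measurable_const_smul γ := by
    refine Continuous.measurable ?_
    change Continuous fun p : ℤ_[2] × ℤ_[2] × ℤ_[2] =>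
      (((H3Z.cx γ : ℤ_[2]) + p.1, (H3Z.cy γ : ℤ_[2]) + p.2.1,
        (H3Z.cz γ : ℤ_[2]) + p.2.2 + H3Z.cx γ * p.2.1) : ℤ_[2] × ℤ_[2] × ℤ_[2])
    fun_prop

/-- The action of `H₃(ℤ)` is free. -/
theorem smul_ne {γ : H3Z} (hγ : γ ≠ 1) (p : Space) : γ • p ≠ p := by
  obtain ⟨x, y, z, rfl⟩ := mk_surjective p
  intro h
  obtain ⟨hx, hy, hz⟩ := mk_inj ((smul_mk γ x y z).symm.trans h)
  have hx' : H3Z.cx γ = 0 := by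
    have : ((H3Z.cx γ : ℤ) : ℤ_[2]) = 0 := by simpa using hx
    exact_mod_cast this
  have hy' : H3Z.cy γ = 0 := by
    have : ((H3Z.cy γ : ℤ) : ℤ_[2]) = 0 := by simpa using hy
    exact_mod_cast this
  have hz' : H3Z.cz γ = 0 := by
    have : ((H3Z.cz γ : ℤ) : ℤ_[2]) = 0 := by simpa [hx'] using hz
    exact_mod_cast this
  exact hγ (H3Z.coords_ext (by simp [hx']) (by simp [hy']) (by simp [hz']))

end Space

/-! ### Points given by digit sequences. -/

/-- The digits of a Boolean sequence as integers. -/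
def digit (x : ℕ → Bool) (i : ℕ) : ℤ := if x i then 1 else 0

theorem digit_nonneg (x : ℕ → Bool) (i : ℕ) : 0 ≤ digit x i := by
  unfold digit; split_ifs <;> norm_num

theorem digit_le_one (x : ℕ → Bool) (i : ℕ) : digit x i ≤ 1 := by
  unfold digit; split_ifs <;> norm_num

theorem digit_injective : Function.Injective digit := by
  intro x y h
  ext i
  have := congrFun h i
  unfold digit at this
  cases hx : x i <;> cases hy : y i <;> simp_all

theorem abs_digit_sub_le (x y : ℕ → Bool) (i : ℕ) : |(digit x - digit y) i| ≤ 1 := by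
  have h1 := digit_nonneg x i
  have h2 := digit_nonneg y i
  have h3 := digit_le_one x i
  have h4 := digit_le_one y i
  rw [Pi.sub_apply, abs_le]
  omega

/-- The point of the space with given digits. -/
def point (x : ℕ → Bool) : Space :=
  .mk (series (xPart (digit x))) 0 (series (zPart (digit x)))

/-- Points have middle coordinate `0`, so the shear term of the action vanishes and `γ` acts on them
as a translation of the outer coordinates. -/
theorem smul_point_eq {γ : H3Z} {x y : ℕ → Bool} (h : γ • point x = point y) :
    H3Z.cy γ = 0 ∧ series (xPart (digit y - digit x)) = H3Z.cx γ ∧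
      series (zPart (digit y - digit x)) = H3Z.cz γ := by
  obtain ⟨h1, h2, h3⟩ := Space.mk_inj ((Space.smul_mk γ _ _ _).symm.trans h)
  refine ⟨?_, ?_, ?_⟩
  · rw [add_zero] at h2
    exact_mod_cast h2
  · rw [xPart_sub, series_sub, ← h1]
    ring
  · rw [zPart_sub, series_sub, ← h3]
    ring

/-- Two digit differences realised by the same `γ` have the same pair of sums, and their discrepancy
has entries of size at most `2`, so `eq_zero_of_series_eq_zero` applies. -/
theorem digit_sub_eq_of_smul_point_eq {γ : H3Z} {x y x' y' : ℕ → Bool}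
    (h : γ • point x = point y) (h' : γ • point x' = point y') :
    digit y - digit x = digit y' - digit x' := by
  obtain ⟨-, h1, h2⟩ := smul_point_eq h
  obtain ⟨-, h1', h2'⟩ := smul_point_eq h'
  refine sub_eq_zero.1 (eq_zero_of_series_eq_zero (fun i => ?_) ?_ ?_)
  · have h3 := abs_le.1 (abs_digit_sub_le y x i)
    have h4 := abs_le.1 (abs_digit_sub_le y' x' i)
    rw [Pi.sub_apply, abs_le]
    omega
  · rw [xPart_sub, series_sub, h1, h1', sub_self]
  · rw [zPart_sub, series_sub, h2, h2', sub_self]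

theorem point_injective : Function.Injective point := by
  intro x y h
  have h1 : (1 : H3Z) • point x = point y := by rw [one_smul, h]
  have h2 : (1 : H3Z) • point x = point x := one_smul _ _
  have := digit_sub_eq_of_smul_point_eq h1 h2
  rw [sub_self, sub_eq_zero] at this
  exact (digit_injective this).symm

theorem continuous_point : Continuous point := by
  have h (f : Bool → ℕ → ℤ) (i : ℕ) : Continuous fun x : ℕ → Bool => f (x i) i :=
    (continuous_of_discreteTopology (f := fun b => f b i)).comp (continuous_apply i)
  change Continuous fun x => ((series (xPart (digit x)), 0, series (zPart (digit x))) :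
    ℤ_[2] × ℤ_[2] × ℤ_[2])
  refine Continuous.prodMk ?_ (Continuous.prodMk continuous_const ?_)
  · exact continuous_series (h fun b i => (if b then 1 else 0) * (direction i).1)
  · exact continuous_series (h fun b i => (if b then 1 else 0) * (direction i).2)

theorem measurableEmbedding_point : MeasurableEmbedding point :=
  (continuous_point.isClosedEmbedding point_injective).measurableEmbedding

/-! ### Coin tossing and the invariant measure. -/

/-- The fair coin. -/
def fairCoin : Measure Bool := (2⁻¹ : ℝ≥0∞) • (Measure.dirac true + Measure.dirac false)

instance : IsProbabilityMeasure fairCoin := ⟨by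
  simp only [fairCoin, Measure.smul_apply, Measure.add_apply, measure_univ, smul_eq_mul]
  rw [one_add_one_eq_two, ENNReal.inv_mul_cancel two_ne_zero ENNReal.ofNat_ne_top]⟩

theorem fairCoin_singleton (b : Bool) : fairCoin {b} = 2⁻¹ := by
  cases b <;> simp [fairCoin]

theorem map_xor_fairCoin (b : Bool) : fairCoin.map (xor b) = fairCoin := by
  have h : Measurable (xor b) := measurable_of_finite _
  rw [fairCoin, Measure.map_smul, Measure.map_add _ _ h, Measure.map_dirac' h, Measure.map_dirac' h]
  cases b <;> simp [add_comm]

/-- Independent tosses of a fair coin. -/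
def coinTosses : Measure (ℕ → Bool) := Measure.infinitePi fun _ => fairCoin

instance : IsProbabilityMeasure coinTosses := by unfold coinTosses; infer_instance

/-- Change the tosses at the positions marked by `d`. -/
def flip (d x : ℕ → Bool) : ℕ → Bool := fun i => xor (d i) (x i)

theorem flip_flip (d x : ℕ → Bool) : flip d (flip d x) = x := by
  ext i
  simp [flip]

theorem measurePreserving_flip (d : ℕ → Bool) :
    MeasurePreserving (flip d) coinTosses coinTosses := by
  have h (i : ℕ) : Measurable (xor (d i)) := measurable_of_finite _
  refine ⟨measurable_pi_lambda _ fun i => (h i).comp (measurable_pi_apply i), ?_⟩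
  have := Measure.infinitePi_map_pi (μ := fun _ : ℕ => fairCoin) h
  simp only [map_xor_fairCoin] at this
  exact this

/-- The distribution of the random point. -/
def pointMeasure : Measure Space := coinTosses.map point

/-- The set of all points. -/
def points : Set Space := Set.range point

theorem measurableSet_points : MeasurableSet points := measurableEmbedding_point.measurableSet_range

theorem pointMeasure_image (s : Set (ℕ → Bool)) : pointMeasure (point '' s) = coinTosses s := by
  rw [pointMeasure, measurableEmbedding_point.map_apply,
    Set.preimage_image_eq _ point_injective]

instance : IsProbabilityMeasure pointMeasure :=
  Measure.isProbabilityMeasure_map continuous_point.measurable.aemeasurable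

theorem pointMeasure_compl : pointMeasure pointsᶜ = 0 := by
  rw [pointMeasure, measurableEmbedding_point.map_apply]
  simp [points]

/-- An element of the group moves the points inside the set of points by flipping digits. -/
theorem exists_flip (γ : H3Z) : ∃ d, ∀ x y, γ • point x = point y → y = flip d x := by
  by_cases h : ∃ x y, γ • point x = point y
  · obtain ⟨x₀, y₀, h₀⟩ := h
    -- Here `flip x₀ y₀` is the exclusive or of the two sequences: it marks the positions where one
    -- reference pair differs.
    refine ⟨flip x₀ y₀, fun x y hxy => ?_⟩
    have h1 := digit_sub_eq_of_smul_point_eq h₀ hxy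
    ext i
    have h2 := congrFun h1 i
    simp only [Pi.sub_apply, digit] at h2
    unfold flip
    cases hx : x i <;> cases hy : y i <;> cases hx' : x₀ i <;> cases hy' : y₀ i <;> simp_all
  · push Not at h
    exact ⟨0, fun x y hxy => (h x y hxy).elim⟩

/-- This is the compatibility needed in `translatesSup_apply`. Where `γ` returns to the points it is
a flip, which preserves coin tossing. There is only an inequality, since `γ` may carry some points
out of the set. -/
theorem restrict_map_pointMeasure_le (γ : H3Z) :
    (pointMeasure.map (γ • ·)).restrict points ≤ pointMeasure := by
  obtain ⟨d, hd⟩ := exists_flip γ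
  refine Measure.le_iff.2 fun A hA => ?_
  have hA' := hA.inter measurableSet_points
  have hm : MeasurableSet ((γ • ·) ⁻¹' (A ∩ points) : Set Space) :=
    measurable_const_smul γ hA'
  rw [Measure.restrict_apply hA, Measure.map_apply (measurable_const_smul γ) hA', pointMeasure,
    measurableEmbedding_point.map_apply, measurableEmbedding_point.map_apply,
    ← (measurePreserving_flip d).measure_preimage
      (continuous_point.measurable hA).nullMeasurableSet]
  refine measure_mono ?_
  rintro x ⟨hxA, y, hy⟩
  change point (flip d x) ∈ A
  rw [← hd x y hy.symm, hy]
  exact hxA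

/-- The invariant measure. -/
def heisMeasure : Measure Space := translatesSup H3Z pointMeasure

theorem measurePreserving_smul (γ : H3Z) :
    MeasurePreserving (fun p : Space => γ • p) heisMeasure heisMeasure :=
  measurePreserving_translatesSup _ γ

instance : SMulInvariantMeasure H3Z Space heisMeasure where
  measure_preimage_smul γ _ hs := (measurePreserving_smul γ).measure_preimage hs.nullMeasurableSet

theorem heisMeasure_of_subset {A : Set Space} (h : A ⊆ points) :
    heisMeasure A = pointMeasure A :=
  translatesSup_apply measurableSet_points restrict_map_pointMeasure_le h

theorem heisMeasure_image (s : Set (ℕ → Bool)) : heisMeasure (point '' s) = coinTosses s := by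
  rw [heisMeasure_of_subset (Set.image_subset_range _ _), pointMeasure_image]

theorem heisMeasure_smul (γ : H3Z) (A : Set Space) : heisMeasure (γ • A) = heisMeasure A :=
  measure_smul heisMeasure γ A

theorem heisMeasure_points : heisMeasure points = 1 := by
  rw [points, ← Set.image_univ, heisMeasure_image, measure_univ]

theorem heisMeasure_compl : heisMeasure (⋃ γ : H3Z, γ • points)ᶜ = 0 :=
  translatesSup_compl_eq_zero measurableSet_points pointMeasure_compl

instance : SigmaFinite heisMeasure := by
  have h : ∀ s ∈ insert (⋃ γ : H3Z, γ • points)ᶜ (Set.range fun γ : H3Z => γ • points),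
      heisMeasure s < ∞ := by
    rintro s (rfl | ⟨γ, rfl⟩)
    · rw [heisMeasure_compl]
      exact ENNReal.zero_lt_top
    · dsimp only
      rw [heisMeasure_smul, heisMeasure_points]
      exact ENNReal.one_lt_top
  have hc := (Set.countable_range fun γ : H3Z => γ • points).insert (⋃ γ : H3Z, γ • points)ᶜ
  refine Measure.sigmaFinite_of_countable hc h ?_
  rw [Set.sUnion_insert, Set.sUnion_range, Set.compl_union_self]

/-- The translates by `(0, b, 0)` have distinct middle coordinates, so they are disjoint, and each
has measure `1`. -/
theorem heisMeasure_univ : heisMeasure Set.univ = ∞ := by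
  have hd : Pairwise (Function.onFun Disjoint fun b : ℕ => H3Z.of 0 b 0 • points) := by
    intro b c hbc
    refine Set.disjoint_left.2 ?_
    rintro _ ⟨_, ⟨x, rfl⟩, rfl⟩ ⟨_, ⟨y, rfl⟩, h⟩
    have h1 : ((H3Z.of 0 b 0)⁻¹ * H3Z.of 0 c 0) • point y = point x := by
      rw [mul_smul, inv_smul_eq_iff]
      exact h
    have h2 := (smul_point_eq h1).1
    simp at h2
    omega
  have h1 := measure_iUnion (μ := heisMeasure) hd fun b => measurableSet_points.const_smul _
  simp only [heisMeasure_smul, heisMeasure_points] at h1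
  refine measure_mono_top (Set.subset_univ (⋃ b : ℕ, H3Z.of 0 b 0 • points)) ?_
  rw [h1]
  simp

/-! ### Towers and approximation by their levels. -/

/-- Sets of sequences which are determined by the first `n` terms. -/
def DependsOnFirst (n : ℕ) (C : Set (ℕ → Bool)) : Prop :=
  ∀ x y : ℕ → Bool, (∀ i < n, x i = y i) → x ∈ C → y ∈ C

theorem exists_dependsOnFirst_approx {D : Set (ℕ → Bool)} (hD : MeasurableSet D) {ε : ℝ≥0∞}
    (hε : 0 < ε) :
    ∃ n C, DependsOnFirst n C ∧ MeasurableSet C ∧ coinTosses (D ∆ C) < ε := by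
  have hdense := Measure.MeasureDense.of_generateFrom_isSetAlgebra_finite coinTosses
    (isSetAlgebra_measurableCylinders (α := fun _ : ℕ => Bool))
    generateFrom_measurableCylinders.symm
  obtain ⟨δ, hδ, hδε⟩ := ENNReal.lt_iff_exists_nnreal_btwn.1 hε
  obtain ⟨C, hC, hlt⟩ := hdense.approx D hD (measure_ne_top _ _) δ (by exact_mod_cast hδ)
  obtain ⟨s, S, hS, rfl⟩ := (mem_measurableCylinders _).1 hC
  refine ⟨s.sup id + 1, _, fun x y hxy hx => ?_, hdense.measurable _ hC,
    hlt.trans (by rwa [ENNReal.ofReal_coe_nnreal])⟩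
  rw [mem_cylinder] at hx ⊢
  convert hx using 1
  ext i
  exact (hxy i (Nat.lt_succ_of_le (Finset.le_sup (f := id) i.2))).symm

/-- The sequences whose first `n` terms vanish. -/
def zeroFirst (n : ℕ) : Set (ℕ → Bool) := {x | ∀ i < n, x i = false}

theorem zeroFirst_eq (n : ℕ) :
    zeroFirst n = Set.pi (Finset.range n : Set ℕ) fun _ => {false} := by
  ext x
  simp [zeroFirst]

theorem measurableSet_zeroFirst (n : ℕ) : MeasurableSet (zeroFirst n) := by
  rw [zeroFirst_eq]
  exact MeasurableSet.pi (Finset.countable_toSet _) fun _ _ => measurableSet_singleton _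

theorem coinTosses_zeroFirst_pos (n : ℕ) : 0 < coinTosses (zeroFirst n) := by
  rw [zeroFirst_eq, coinTosses, Measure.infinitePi_pi _ fun _ _ => measurableSet_singleton _]
  simp only [fairCoin_singleton, Finset.prod_const]
  exact ENNReal.pow_pos (by simp) _

/-- The bases of the towers. -/
def base (n : ℕ) : Set Space := point '' zeroFirst n

theorem measurableSet_base (n : ℕ) : MeasurableSet (base n) :=
  measurableEmbedding_point.measurableSet_image.2 (measurableSet_zeroFirst n)

theorem heisMeasure_base_pos (n : ℕ) : 0 < heisMeasure (base n) := by
  rw [base, heisMeasure_image]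
  exact coinTosses_zeroFirst_pos n

theorem heisMeasure_base_lt_top (n : ℕ) : heisMeasure (base n) < ∞ := by
  rw [base, heisMeasure_image]
  exact measure_lt_top _ _

/-- The shapes of the towers. -/
def box (n : ℕ) : Finset H3Z :=
  (Finset.Ico (-halfScale n) (halfScale n) ×ˢ Finset.Icc (-n : ℤ) n ×ˢ
    Finset.Ico (-halfScale n) (halfScale n)).map H3Z.equivInt.symm.toEmbedding

theorem mem_box {n : ℕ} {γ : H3Z} : γ ∈ box n ↔
    (-halfScale n ≤ H3Z.cx γ ∧ H3Z.cx γ < halfScale n) ∧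
      (-(n : ℤ) ≤ H3Z.cy γ ∧ H3Z.cy γ ≤ n) ∧
      (-halfScale n ≤ H3Z.cz γ ∧ H3Z.cz γ < halfScale n) := by
  simp [box, Finset.mem_map_equiv, H3Z.equivInt]

theorem scale_dvd_of_smul_point_eq {n : ℕ} {γ : H3Z} {x y : ℕ → Bool} (hx : x ∈ zeroFirst n)
    (hy : y ∈ zeroFirst n) (h : γ • point x = point y) :
    scale n ∣ H3Z.cx γ ∧ scale n ∣ H3Z.cz γ := by
  obtain ⟨-, h1, h2⟩ := smul_point_eq h
  have h3 : ∀ i < n, (digit y - digit x) i = 0 := fun i hi => by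
    simp [digit, hx i hi, hy i hi]
  have key (a : ℕ → ℤ) (k : ℤ) (ha : ∀ i < n, a i = 0) (hk : series a = k) : scale n ∣ k := by
    have h4 := dvd_series_sub_partialSum a n
    have h5 : partialSum a n = 0 := Finset.sum_eq_zero fun i hi => by
      rw [ha i (Finset.mem_range.1 hi), mul_zero]
    rw [h5, hk, Int.cast_zero, sub_zero] at h4
    exact scale_dvd_int_iff.1 h4
  exact ⟨key _ _ (fun i hi => by rw [xPart, h3 i hi, zero_mul]) h1,
    key _ _ (fun i hi => by rw [zPart, h3 i hi, zero_mul]) h2⟩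

/-- If two levels meet, the quotient of their labels is a return to the base: its middle coordinate
is `0` and its outer ones are divisible by `scale n`. The half-open sides of the box contain just
one representative of each residue modulo `scale n`. -/
theorem pairwiseDisjoint_box (n : ℕ) :
    (box n : Set H3Z).PairwiseDisjoint fun f => f • base n := by
  intro γ hγ δ hδ hne
  refine Set.disjoint_left.2 ?_
  rintro _ ⟨_, ⟨x, hx, rfl⟩, rfl⟩ ⟨_, ⟨y, hy, rfl⟩, h⟩
  have h1 : (γ⁻¹ * δ) • point y = point x := by
    rw [mul_smul, inv_smul_eq_iff]
    exact h
  have h2 := (smul_point_eq h1).1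
  obtain ⟨h3, h4⟩ := scale_dvd_of_smul_point_eq hy hx h1
  have h5 := mem_box.1 hγ
  have h6 := mem_box.1 hδ
  have h7 := scale_eq n
  rw [H3Z.cy_mul, H3Z.cy_inv] at h2
  have h8 : H3Z.cy δ = H3Z.cy γ := by linarith
  have h9 : H3Z.cz (γ⁻¹ * δ) = H3Z.cz δ - H3Z.cz γ := by
    simp [h8]
    ring
  have h10 : H3Z.cx (γ⁻¹ * δ) = H3Z.cx δ - H3Z.cx γ := by
    simp
    ring
  rw [h10] at h3
  rw [h9] at h4
  have h11 := eq_zero_of_scale_dvd h3 (by rw [abs_lt]; omega)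
  have h12 := eq_zero_of_scale_dvd h4 (by rw [abs_lt]; omega)
  exact hne (H3Z.coords_ext (by linarith) h8.symm (by linarith))

theorem series_eq_partialSum {a : ℕ → ℤ} {n : ℕ} (h : ∀ i, n ≤ i → a i = 0) :
    series a = (partialSum a n : ℤ) := by
  rw [series, partialSum, tsum_eq_sum (s := Finset.range n)]
  · push_cast
    rfl
  · intro i hi
    rw [h i (by simpa using hi), mul_zero, Int.cast_zero]

/-- The sequence which continues the first `n` terms of `x` with the terms of `y`. -/
def splice (n : ℕ) (x y : ℕ → Bool) (i : ℕ) : Bool := if i < n then x i else y i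

/-- The group element given by the first `n` terms. -/
def step (n : ℕ) (x : ℕ → Bool) : H3Z :=
  H3Z.of (partialSum (xPart (digit x)) n) 0 (partialSum (zPart (digit x)) n)

theorem step_smul_point {n : ℕ} (x : ℕ → Bool) {y : ℕ → Bool} (hy : y ∈ zeroFirst n) :
    step n x • point y = point (splice n x y) := by
  have h1 : ∀ i < n, (digit (splice n x y) - digit y) i = digit x i := fun i hi => by
    simp [digit, splice, hi, hy i hi]
  have h2 : ∀ i, n ≤ i → (digit (splice n x y) - digit y) i = 0 := fun i hi => by
    simp [digit, splice, not_lt.2 hi]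
  have hx : series (xPart (digit (splice n x y))) =
      (partialSum (xPart (digit x)) n : ℤ) + series (xPart (digit y)) := by
    rw [← sub_eq_iff_eq_add, ← series_sub, ← xPart_sub,
      series_eq_partialSum fun i hi => by rw [xPart, h2 i hi, zero_mul]]
    congr 1
    exact Finset.sum_congr rfl fun i hi => by rw [xPart, h1 i (Finset.mem_range.1 hi), xPart]
  have hz : series (zPart (digit (splice n x y))) =
      (partialSum (zPart (digit x)) n : ℤ) + series (zPart (digit y)) := by
    rw [← sub_eq_iff_eq_add, ← series_sub, ← zPart_sub,
      series_eq_partialSum fun i hi => by rw [zPart, h2 i hi, zero_mul]]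
    congr 1
    exact Finset.sum_congr rfl fun i hi => by rw [zPart, h1 i (Finset.mem_range.1 hi), zPart]
  rw [point, point, Space.smul_mk, hx, hz]
  simp [step]

theorem exists_splice_eq (n : ℕ) (x : ℕ → Bool) : ∃ y ∈ zeroFirst n, splice n x y = x := by
  refine ⟨fun i => if i < n then false else x i, fun i hi => by simp [hi], ?_⟩
  ext i
  by_cases hi : i < n <;> simp [splice, hi]

theorem abs_digit_le (x : ℕ → Bool) (i : ℕ) : |digit x i| ≤ 1 := by
  rw [abs_of_nonneg (digit_nonneg x i)]
  exact digit_le_one x i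

/-- The outer coordinates of `step n x` take up at most half of `halfScale n` once `n` is positive,
which leaves room for the fixed displacement by `γ`. No shear term arises, as the middle coordinate
of a step is `0`. -/
theorem mul_step_mem_box (γ : H3Z) : ∃ N, ∀ n ≥ N, ∀ x, γ * step n x ∈ box n := by
  refine ⟨2 * (H3Z.cx γ).natAbs + (H3Z.cy γ).natAbs + 2 * (H3Z.cz γ).natAbs + 1,
    fun n hn x => ?_⟩
  have h1 := abs_le.1 (abs_partialSum_le (abs_xPart_le (abs_digit_le x)) n)
  have h2 := abs_le.1 (abs_partialSum_le (abs_zPart_le (abs_digit_le x)) n)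
  have h3 := mul_partialBound_le n
  have h4 := partialBound_nonneg n
  have h5 := lt_halfScale n
  have h6 : 2 * partialBound n ≤ halfScale n :=
    le_trans (mul_le_mul_of_nonneg_right (by omega) h4) h3
  rw [mem_box]
  simp only [step, H3Z.cx_mul, H3Z.cy_mul, H3Z.cz_mul, H3Z.cx_of, H3Z.cy_of, H3Z.cz_of, mul_zero]
  omega

/-- For `n ≥ m` the set `C` splits according to the first `n` digits, and fixing these digits to
those of `x` gives the level `step n x • base n`. -/
theorem exists_eq_union_levels {m : ℕ} {C : Set (ℕ → Bool)} (hC : DependsOnFirst m C) (γ : H3Z) :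
    ∀ᶠ n in atTop, ∃ S ⊆ box n, γ • point '' C = ⋃ f ∈ S, f • base n := by
  classical
  obtain ⟨N, hN⟩ := mul_step_mem_box γ
  filter_upwards [eventually_ge_atTop N, eventually_ge_atTop m] with n hn hm
  refine ⟨(box n).filter fun f => f • base n ⊆ γ • point '' C, Finset.filter_subset _ _, ?_⟩
  apply Set.Subset.antisymm
  · rintro _ ⟨_, ⟨x, hx, rfl⟩, rfl⟩
    obtain ⟨y, hy, hxy⟩ := exists_splice_eq n x
    refine Set.mem_biUnion (x := γ * step n x) (Finset.mem_filter.2 ⟨hN n hn x, ?_⟩) ?_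
    · rintro _ ⟨_, ⟨z, hz, rfl⟩, rfl⟩
      dsimp only
      rw [mul_smul, step_smul_point x hz]
      refine Set.smul_mem_smul_set ⟨_, hC x _ (fun i hi => ?_) hx, rfl⟩
      simp [splice, hi.trans_le hm]
    · dsimp only
      rw [← hxy, ← step_smul_point x hy, ← mul_smul, hxy]
      exact Set.smul_mem_smul_set ⟨y, hy, rfl⟩
  · refine Set.iUnion₂_subset fun f hf => ?_
    exact (Finset.mem_filter.1 hf).2

/-- Sets which are approximated by unions of levels of the towers. -/
def Approximable (A : Set Space) : Prop :=
  ∀ ε : ℝ≥0∞, 0 < ε → ∀ᶠ n in atTop, ∃ S ⊆ box n, heisMeasure (A ∆ ⋃ f ∈ S, f • base n) ≤ ε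

theorem approximable_smul_image {D : Set (ℕ → Bool)} (hD : MeasurableSet D) (γ : H3Z) :
    Approximable (γ • point '' D) := by
  intro ε hε
  obtain ⟨m, C, hC, -, hlt⟩ := exists_dependsOnFirst_approx hD hε
  filter_upwards [exists_eq_union_levels hC γ] with n hn
  obtain ⟨S, hS, h⟩ := hn
  refine ⟨S, hS, ?_⟩
  rw [← h, ← Set.smul_set_symmDiff, heisMeasure_smul, ← Set.image_symmDiff point_injective,
    heisMeasure_image]
  exact hlt.le

theorem approximable_of_subset {A : Set Space} (hA : MeasurableSet A) {γ : H3Z}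
    (h : A ⊆ γ • points) : Approximable A := by
  have h1 : A = γ • point '' (point ⁻¹' (γ⁻¹ • A)) := by
    rw [Set.image_preimage_eq_of_subset, smul_inv_smul]
    rwa [← Set.subset_smul_set_iff]
  rw [h1]
  exact approximable_smul_image (continuous_point.measurable (hA.const_smul γ⁻¹)) γ

theorem Approximable.union {A B : Set Space} (hA : Approximable A) (hB : Approximable B) :
    Approximable (A ∪ B) := by
  classical
  intro ε hε
  have hε2 : 0 < ε / 2 := ENNReal.half_pos hε.ne'
  filter_upwards [hA _ hε2, hB _ hε2] with n ⟨S, hS, h1⟩ ⟨T, hT, h2⟩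
  refine ⟨S ∪ T, Finset.union_subset hS hT, ?_⟩
  rw [Finset.set_biUnion_union]
  calc _ ≤ _ := measure_mono (Set.union_symmDiff_union_subset ..)
    _ ≤ _ := measure_union_le _ _
    _ ≤ ε / 2 + ε / 2 := add_le_add h1 h2
    _ = ε := ENNReal.add_halves ε

theorem approximable_empty : Approximable ∅ := fun ε _ =>
  Eventually.of_forall fun n => ⟨∅, Finset.empty_subset _, by simp⟩

theorem Approximable.biUnion {ι : Type*} (s : Finset ι) (A : ι → Set Space)
    (h : ∀ i ∈ s, Approximable (A i)) : Approximable (⋃ i ∈ s, A i) := by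
  classical
  induction s using Finset.induction_on with
  | empty => simpa using approximable_empty
  | insert i s hi ih =>
    rw [Finset.set_biUnion_insert]
    exact (h i (Finset.mem_insert_self _ _)).union
      (ih fun j hj => h j (Finset.mem_insert_of_mem hj))

/-- The translates of `points` cover almost everything and finite measure gives continuity from
above, so finitely many of them already capture `A` up to `ε / 2`. -/
theorem approximable_of_lt_top {A : Set Space} (hA : MeasurableSet A) (hfin : heisMeasure A < ∞) :
    Approximable A := by
  obtain ⟨g, hg⟩ := exists_surjective_nat H3Z
  intro ε hε
  have hε2 : 0 < ε / 2 := ENNReal.half_pos hε.ne'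
  let P (J : ℕ) : Set Space := ⋃ j ∈ Finset.range J, A ∩ g j • points
  have hP (J : ℕ) : MeasurableSet (P J) := Finset.measurableSet_biUnion _ fun j _ =>
    hA.inter (measurableSet_points.const_smul _)
  have hPA (J : ℕ) : P J ⊆ A := Set.iUnion₂_subset fun j _ => Set.inter_subset_left
  have hlim : Tendsto (fun J => heisMeasure (A \ P J)) atTop (𝓝 (heisMeasure (⋂ J, A \ P J))) := by
    refine tendsto_measure_iInter_atTop (fun J => (hA.diff (hP J)).nullMeasurableSet)
      (fun I J hIJ => Set.sdiff_subset_sdiff_right ?_)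
      ⟨0, ((measure_mono Set.sdiff_subset).trans_lt hfin).ne⟩
    exact Set.biUnion_subset_biUnion_left (Finset.range_mono hIJ)
  have hzero : heisMeasure (⋂ J, A \ P J) = 0 := by
    refine measure_mono_null (t := (⋃ γ : H3Z, γ • points)ᶜ) (fun p hp hpU => ?_)
      heisMeasure_compl
    obtain ⟨γ, hγ⟩ := Set.mem_iUnion.1 hpU
    obtain ⟨j, rfl⟩ := hg γ
    obtain ⟨hpA, hpP⟩ := Set.mem_iInter.1 hp (j + 1)
    exact hpP (Set.mem_biUnion (Finset.self_mem_range_succ j) ⟨hpA, hγ⟩)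
  rw [hzero] at hlim
  obtain ⟨J, hJ⟩ := (hlim.eventually_lt_const hε2).exists
  have happ : Approximable (P J) := Approximable.biUnion _ _ fun j _ =>
    approximable_of_subset (hA.inter (measurableSet_points.const_smul _)) Set.inter_subset_right
  filter_upwards [happ _ hε2] with n ⟨S, hS, h⟩
  refine ⟨S, hS, ?_⟩
  calc _ ≤ _ := measure_symmDiff_le A (P J) _
    _ ≤ ε / 2 + ε / 2 := by
      refine add_le_add ?_ h
      rw [Set.symmDiff_def, Set.sdiff_eq_empty.2 (hPA J), Set.union_empty]
      exact hJ.le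
    _ = ε := ENNReal.add_halves ε

theorem exists_tendsto_symmDiff {A : Set Space} (hA : MeasurableSet A)
    (hfin : heisMeasure A < ∞) :
    ∃ S : ℕ → Finset H3Z, (∀ n, S n ⊆ box n) ∧
      Tendsto (fun n => heisMeasure (A ∆ ⋃ f ∈ S n, f • base n)) atTop (𝓝 0) := by
  -- Taking an optimal family of levels for each `n` yields one sequence that works for every `ε`.
  have h (n : ℕ) := Finset.exists_min_image (box n).powerset
    (fun S => heisMeasure (A ∆ ⋃ f ∈ S, f • base n)) ⟨∅, by simp⟩
  choose S hS hmin using h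
  refine ⟨S, fun n => Finset.mem_powerset.1 (hS n), ENNReal.tendsto_nhds_zero.2 fun ε hε => ?_⟩
  filter_upwards [approximable_of_lt_top hA hfin ε hε] with n ⟨T, hT, h⟩
  exact (hmin n T (Finset.mem_powerset.2 hT)).trans h

/-! ### The boxes form a Følner sequence. -/

/-- The elements of a box at distance at least `R` (resp. `B`) from its boundary. -/
def innerBox (n : ℕ) (R B : ℤ) : Finset H3Z :=
  (Finset.Ico (-halfScale n + R) (halfScale n - R) ×ˢ Finset.Icc (-n + B : ℤ) (n - B) ×ˢ
    Finset.Ico (-halfScale n + R) (halfScale n - R)).map H3Z.equivInt.symm.toEmbedding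

theorem mem_innerBox {n : ℕ} {R B : ℤ} {γ : H3Z} : γ ∈ innerBox n R B ↔
    (-halfScale n + R ≤ H3Z.cx γ ∧ H3Z.cx γ < halfScale n - R) ∧
      (-(n : ℤ) + B ≤ H3Z.cy γ ∧ H3Z.cy γ ≤ n - B) ∧
      (-halfScale n + R ≤ H3Z.cz γ ∧ H3Z.cz γ < halfScale n - R) := by
  simp [innerBox, Finset.mem_map_equiv, H3Z.equivInt]

theorem card_innerBox {n : ℕ} {R B : ℤ} (hR : R ≤ halfScale n) (hB : B ≤ n) :
    ((innerBox n R B).card : ℤ) =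
      2 * (halfScale n - R) * ((2 * (n - B) + 1) * (2 * (halfScale n - R))) := by
  rw [innerBox, Finset.card_map, Finset.card_product, Finset.card_product, Int.card_Ico,
    Int.card_Icc]
  push_cast
  rw [Int.toNat_of_nonneg (by omega), Int.toNat_of_nonneg (by omega)]
  ring

theorem box_eq_innerBox (n : ℕ) : box n = innerBox n 0 0 := by
  simp [box, innerBox]

theorem sq_le_halfScale (n : ℕ) : ((n : ℤ) + 1) * (n + 1) ≤ halfScale n := by
  have h : n + 1 ≤ 2 ^ n := Nat.lt_two_pow_self
  have h2 : (n + 1) * (n + 1) ≤ 2 ^ n * 2 ^ n := Nat.mul_le_mul h h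
  rw [← pow_add] at h2
  have h3 : 2 ^ (n + n) ≤ 2 ^ (n * (n + 2)) := Nat.pow_le_pow_right two_pos (by nlinarith)
  unfold halfScale
  exact_mod_cast h2.trans h3

/-- The lost proportion is `O(1 / n)`: `halfScale n` is at least `(n + 1) ^ 2`, so a margin of order
`n` in the outer directions costs `O(1 / n)`, as does a constant margin among the `2 * n + 1` middle
values. -/
theorem card_diff_innerBox_le {n : ℕ} {α B : ℤ} (hα : 0 ≤ α) (hB : 0 ≤ B) (hn : α + B ≤ n) :
    ((n : ℤ) + 1) * ((box n).card - (innerBox n (α * (n + 1)) B).card) ≤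
      (2 * α + 2 * B) * (box n).card := by
  have h1 := sq_le_halfScale n
  have h2 : α * (n + 1) * (n + 1) ≤ α * halfScale n := by nlinarith
  have h3 : α * (n + 1) ≤ halfScale n := by nlinarith
  have h4 := halfScale_pos n
  rw [box_eq_innerBox, card_innerBox h4.le (by omega), card_innerBox h3 (by omega)]
  generalize halfScale n = h at *
  have hR : 0 ≤ α * (n + 1) := by positivity
  generalize α * ((n : ℤ) + 1) = R at *
  have hn0 : (0 : ℤ) ≤ n := by positivity
  generalize (n : ℤ) = k at *
  have e1 : (h - R) * (h - R) ≤ h * h := by nlinarith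
  have e2 : h * h - (h - R) * (h - R) ≤ 2 * h * R := by nlinarith
  have e3 : (k + 1) * (h * h - (h - R) * (h - R)) ≤ 2 * α * (h * h) := by
    calc _ ≤ (k + 1) * (2 * h * R) := mul_le_mul_of_nonneg_left e2 (by omega)
      _ = 2 * h * (R * (k + 1)) := by ring
      _ ≤ 2 * h * (α * h) := mul_le_mul_of_nonneg_left h2 (by omega)
      _ = _ := by ring
  have e4 := mul_le_mul_of_nonneg_right e3 (show 0 ≤ 4 * (2 * k + 1) by omega)
  have e5 := mul_le_mul_of_nonneg_right e1 (show 0 ≤ 8 * B * (k + 1) by positivity)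
  have e6 : 0 ≤ 8 * B * (h * h) * k := by positivity
  nlinarith

/-- Translating `δ` by `γ⁻¹` shears the corner entry by `cx γ * cy δ`, with `|cy δ| ≤ n`. This is
why the outer margin must grow linearly in `n`, while the middle margin stays constant. -/
theorem innerBox_subset_smul (γ : H3Z) (n : ℕ) {α : ℤ}
    (hα : α = |H3Z.cx γ| + |H3Z.cz γ| + |H3Z.cx γ| * |H3Z.cy γ|) :
    innerBox n (α * (n + 1)) |H3Z.cy γ| ⊆ box n ∩ (box n).image (γ * ·) := by
  intro δ hδ
  obtain ⟨h1, h2, h3⟩ := mem_innerBox.1 hδ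
  have a1 := abs_nonneg (H3Z.cx γ)
  have a2 := abs_nonneg (H3Z.cy γ)
  have a3 := abs_nonneg (H3Z.cz γ)
  have a4 : 0 ≤ |H3Z.cx γ| * |H3Z.cy γ| := by positivity
  have a5 : |H3Z.cx γ| * n + |H3Z.cx γ| + |H3Z.cz γ| + |H3Z.cx γ| * |H3Z.cy γ|
      ≤ α * (n + 1) := by
    have : (0 : ℤ) ≤ n := by positivity
    rw [hα]
    nlinarith [mul_nonneg a3 this, mul_nonneg a4 this]
  have a6 : 0 ≤ |H3Z.cx γ| * n := by positivity
  have b1 := abs_le.1 (le_refl |H3Z.cx γ|)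
  have b2 := abs_le.1 (le_refl |H3Z.cy γ|)
  have b3 := abs_le.1 (le_refl |H3Z.cz γ|)
  have b4 : |H3Z.cx γ * H3Z.cy γ| ≤ |H3Z.cx γ| * |H3Z.cy γ| := (abs_mul _ _).le
  have b5 : |H3Z.cx γ * H3Z.cy δ| ≤ |H3Z.cx γ| * n := by
    rw [abs_mul]
    exact mul_le_mul_of_nonneg_left (abs_le.2 ⟨by omega, by omega⟩) a1
  rw [abs_le] at b4 b5
  refine Finset.mem_inter.2 ⟨mem_box.2 ⟨⟨?_, ?_⟩, ⟨?_, ?_⟩, ⟨?_, ?_⟩⟩,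
    Finset.mem_image.2 ⟨γ⁻¹ * δ, mem_box.2 ?_, mul_inv_cancel_left _ _⟩⟩
  any_goals omega
  simp only [H3Z.cx_mul, H3Z.cy_mul, H3Z.cz_mul, H3Z.cx_inv, H3Z.cy_inv, H3Z.cz_inv, neg_mul]
  refine ⟨⟨?_, ?_⟩, ⟨?_, ?_⟩, ⟨?_, ?_⟩⟩ <;> omega

theorem box_nonempty (n : ℕ) : (box n).Nonempty :=
  ⟨1, mem_box.2 (by
    have := halfScale_pos n
    simp
    omega)⟩

theorem isFolnerSequence_box : IsFolnerSequence box := by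
  classical
  let _ : MeasurableSpace H3Z := ⊤
  have hcount (s : Finset H3Z) : (Measure.count : Measure H3Z) s = s.card :=
    Measure.count_apply_finset s
  refine ⟨Eventually.of_forall fun n => trivial, Eventually.of_forall fun n => ?_,
    Eventually.of_forall fun n => ?_, fun γ => ?_⟩
  · rw [hcount]
    simpa using (box_nonempty n).ne_empty
  · rw [hcount]
    exact ENNReal.natCast_ne_top _
  · obtain ⟨α, hα⟩ : ∃ α, α = |H3Z.cx γ| + |H3Z.cz γ| + |H3Z.cx γ| * |H3Z.cy γ| := ⟨_, rfl⟩
    have hα0 : 0 ≤ α := by rw [hα]; positivity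
    have hB0 : 0 ≤ |H3Z.cy γ| := abs_nonneg _
    have hlim : Tendsto (fun n : ℕ => ENNReal.ofReal
        ((2 * (2 * α + 2 * |H3Z.cy γ|) : ℤ) / ((n : ℝ) + 1))) atTop (𝓝 0) := by
      rw [← ENNReal.ofReal_zero]
      refine ENNReal.tendsto_ofReal ?_
      exact tendsto_const_nhds.div_atTop
        (tendsto_atTop_add_const_right _ _ tendsto_natCast_atTop_atTop)
    refine tendsto_of_tendsto_of_tendsto_of_le_of_le' tendsto_const_nhds hlim
      (Eventually.of_forall fun n => zero_le) ?_
    filter_upwards [eventually_ge_atTop (α + |H3Z.cy γ|).toNat] with n hn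
    have hn' : α + |H3Z.cy γ| ≤ n := Int.toNat_le.1 hn
    have hs : (γ • (box n : Set H3Z)) = ((box n).image (γ * ·) : Finset H3Z) := by
      rw [Finset.coe_image]
      rfl
    have hcard : ((box n).image (γ * ·)).card = (box n).card :=
      Finset.card_image_of_injective _ (mul_right_injective γ)
    have hsub := innerBox_subset_smul γ n hα
    have hsd : (((box n).image (γ * ·) ∆ box n).card : ℤ) ≤
        2 * ((box n).card - (innerBox n (α * (n + 1)) |H3Z.cy γ|).card) := by
      have h1 : (box n).image (γ * ·) ∆ box n ⊆
          ((box n).image (γ * ·) \ innerBox n (α * (n + 1)) |H3Z.cy γ|) ∪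
            (box n \ innerBox n (α * (n + 1)) |H3Z.cy γ|) := by
        intro δ hδ
        rw [Finset.mem_symmDiff] at hδ
        rw [Finset.mem_union, Finset.mem_sdiff, Finset.mem_sdiff]
        have := @hsub δ
        rw [Finset.mem_inter] at this
        tauto
      have h2 := (Finset.card_le_card h1).trans (Finset.card_union_le _ _)
      have h3 := Finset.card_sdiff_add_card_eq_card (hsub.trans Finset.inter_subset_left)
      have h4 := Finset.card_sdiff_add_card_eq_card (hsub.trans Finset.inter_subset_right)
      omega
    have hmain := card_diff_innerBox_le hα0 hB0 hn'
    have hpos : 0 < ((box n).card : ℝ) := by exact_mod_cast (box_nonempty n).card_pos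
    rw [hs, ← Finset.coe_symmDiff, hcount, hcount, ← ENNReal.ofReal_natCast,
      ← ENNReal.ofReal_natCast (n := (box n).card), ← ENNReal.ofReal_div_of_pos hpos]
    refine ENNReal.ofReal_le_ofReal ?_
    rw [div_le_div_iff₀ hpos (by positivity)]
    have h5 : (((box n).image (γ * ·) ∆ box n).card : ℤ) * (n + 1) ≤
        2 * (2 * α + 2 * |H3Z.cy γ|) * (box n).card := by nlinarith
    exact_mod_cast h5

theorem isRankOne_heisMeasure : IsRankOne H3Z heisMeasure :=
  ⟨base, box, isFolnerSequence_box,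
    fun n => ⟨measurableSet_base n, heisMeasure_base_pos n, heisMeasure_base_lt_top n⟩,
    pairwiseDisjoint_box, fun _ hA hfin => exists_tendsto_symmDiff hA hfin⟩

/-! ### Recurrence along the integral lines and the central line. -/

/-- The sequence with a single `true` at position `m`. -/
def mark (m : ℕ) (i : ℕ) : Bool := decide (i = m)

theorem measurableSet_flip_inter {D : Set (ℕ → Bool)} (hD : MeasurableSet D) (m : ℕ) :
    MeasurableSet {x | x ∈ D ∧ flip (mark m) x ∈ D ∧ x m = false} := by
  have h : MeasurableSet {x : ℕ → Bool | x m = false} :=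
    measurable_pi_apply (X := fun _ : ℕ => Bool) m (measurableSet_singleton false)
  exact hD.inter (((measurePreserving_flip (mark m)).measurable hD).inter h)

/-- Flipping a late digit moves a positive part of any set of positive measure into the set. -/
theorem exists_coinTosses_flip_pos {D : Set (ℕ → Bool)} (hD : MeasurableSet D)
    (hpos : 0 < coinTosses D) :
    ∃ N, ∀ m ≥ N, 0 < coinTosses {x | x ∈ D ∧ flip (mark m) x ∈ D ∧ x m = false} := by
  obtain ⟨N, C, hC, hCm, hlt⟩ := exists_dependsOnFirst_approx hD (ENNReal.half_pos hpos.ne')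
  refine ⟨N, fun m hm => ?_⟩
  have hflip := measurePreserving_flip (mark m)
  have hCflip : ∀ x, x ∈ C → flip (mark m) x ∈ C := fun x => hC x _ fun i hi => by
    simp [flip, mark, (hi.trans_le hm).ne]
  have hHm := measurableSet_flip_inter hD m
  by_contra hzero
  have hH : coinTosses {x | x ∈ D ∧ flip (mark m) x ∈ D ∧ x m = false} = 0 := by
    simpa using hzero
  have hH' : coinTosses (flip (mark m) ⁻¹'
      {x | x ∈ D ∧ flip (mark m) x ∈ D ∧ x m = false}) = 0 := by
    rw [hflip.measure_preimage hHm.nullMeasurableSet, hH]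
  have hDC : coinTosses (D \ C) ≤ coinTosses (D ∆ C) := measure_mono fun x hx => Or.inl hx
  have hCD : coinTosses (flip (mark m) ⁻¹' (C \ D)) ≤ coinTosses (D ∆ C) := by
    rw [hflip.measure_preimage (hCm.diff hD).nullMeasurableSet]
    exact measure_mono fun x hx => Or.inr hx
  -- Up to two errors, each of measure less than half that of `D`, a point of `D` stays in `D` after
  -- the flip; then the point or its flip has digit `m` equal to `false`. If the set in question
  -- were null, `D` would be too small.
  have hcover : D ⊆ ({x | x ∈ D ∧ flip (mark m) x ∈ D ∧ x m = false} ∪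
      flip (mark m) ⁻¹' {x | x ∈ D ∧ flip (mark m) x ∈ D ∧ x m = false}) ∪
      ((D \ C) ∪ flip (mark m) ⁻¹' (C \ D)) := by
    intro x hx
    by_cases hxC : x ∈ C
    · by_cases hxD : flip (mark m) x ∈ D
      · left
        cases hxm : x m
        · exact .inl ⟨hx, hxD, hxm⟩
        · refine .inr ⟨hxD, by rwa [flip_flip], ?_⟩
          simp [flip, mark, hxm]
      · exact .inr (.inr ⟨hCflip x hxC, hxD⟩)
    · exact .inr (.inl ⟨hx, hxC⟩)
  have := calc coinTosses D ≤ _ := measure_mono hcover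
    _ ≤ _ := measure_union_le _ _
    _ ≤ _ := add_le_add (measure_union_le _ _) (measure_union_le _ _)
    _ ≤ (0 + 0) + (coinTosses (D ∆ C) + coinTosses (D ∆ C)) :=
      add_le_add (add_le_add hH.le hH'.le) (add_le_add hDC hCD)
    _ = coinTosses (D ∆ C) + coinTosses (D ∆ C) := by rw [add_zero, zero_add]
    _ < coinTosses D / 2 + coinTosses D / 2 := ENNReal.add_lt_add hlt hlt
    _ = coinTosses D := ENNReal.add_halves _
  exact lt_irrefl _ this

/-- The `m`-th step. -/
def singleStep (m : ℕ) : H3Z := H3Z.of (scale m * (direction m).1) 0 (scale m * (direction m).2)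

theorem singleStep_smul_point {m : ℕ} {x : ℕ → Bool} (hx : x m = false) :
    singleStep m • point x = point (flip (mark m) x) := by
  have h : digit (flip (mark m) x) - digit x = Pi.single m 1 := by
    ext i
    by_cases hi : i = m
    · subst hi
      simp [digit, flip, mark, hx]
    · simp [digit, flip, mark, hi]
  have hx' : xPart (Pi.single m 1) = Pi.single m (direction m).1 := by
    ext i
    by_cases hi : i = m
    · subst hi; simp [xPart]
    · simp [xPart, hi]
  have hz' : zPart (Pi.single m 1) = Pi.single m (direction m).2 := by
    ext i
    by_cases hi : i = m
    · subst hi; simp [zPart]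
    · simp [zPart, hi]
  have h1 : series (xPart (digit (flip (mark m) x))) =
      ((scale m * (direction m).1 : ℤ) : ℤ_[2]) + series (xPart (digit x)) := by
    rw [← sub_eq_iff_eq_add, ← series_sub, ← xPart_sub, h, hx', series_single]
  have h2 : series (zPart (digit (flip (mark m) x))) =
      ((scale m * (direction m).2 : ℤ) : ℤ_[2]) + series (zPart (digit x)) := by
    rw [← sub_eq_iff_eq_add, ← series_sub, ← zPart_sub, h, hz', series_single]
  rw [point, point, Space.smul_mk, h1, h2]
  simp [singleStep]

/-- Some translate `g • points` meets `A` in positive measure. Pulled back by `g`, a late digit flip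
is the action of `singleStep m`, so on the translate itself it is the conjugate by `g`. -/
theorem exists_measure_inter_conj_pos {A : Set Space} (hA : MeasurableSet A)
    (hpos : 0 < heisMeasure A) :
    ∃ g : H3Z, ∃ N, ∀ m ≥ N, 0 < heisMeasure (A ∩ (g * singleStep m * g⁻¹) • A) := by
  obtain ⟨g, hg⟩ : ∃ g : H3Z, 0 < heisMeasure (A ∩ g • points) := by
    by_contra! h
    have h1 : heisMeasure (⋃ g : H3Z, A ∩ g • points) = 0 :=
      measure_iUnion_null fun g => le_antisymm (h g) zero_le
    have h2 : A ⊆ (⋃ g : H3Z, A ∩ g • points) ∪ (⋃ g : H3Z, g • points)ᶜ := by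
      intro p hp
      rw [← Set.inter_iUnion]
      by_cases h3 : p ∈ ⋃ g : H3Z, g • points
      · exact .inl ⟨hp, h3⟩
      · exact .inr h3
    exact hpos.ne' (measure_mono_null h2 (measure_union_null h1 heisMeasure_compl))
  let D : Set (ℕ → Bool) := point ⁻¹' (g⁻¹ • A)
  have hDA : ∀ x, x ∈ D ↔ g • point x ∈ A := fun x => Set.mem_inv_smul_set_iff
  have hD : MeasurableSet D := continuous_point.measurable (hA.const_smul g⁻¹)
  have hDpos : 0 < coinTosses D := by
    refine hg.trans_le ?_
    rw [← heisMeasure_image, ← heisMeasure_smul g (point '' D)]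
    refine measure_mono ?_
    rintro _ ⟨hp, _, ⟨x, rfl⟩, rfl⟩
    exact Set.smul_mem_smul_set (Set.mem_image_of_mem point ((hDA x).2 hp))
  obtain ⟨N, hN⟩ := exists_coinTosses_flip_pos hD hDpos
  refine ⟨g, N, fun m hm => (hN m hm).trans_le ?_⟩
  have hflip := measurePreserving_flip (mark m)
  have hHm := measurableSet_flip_inter hD m
  rw [← hflip.measure_preimage hHm.nullMeasurableSet, ← heisMeasure_image, ← heisMeasure_smul g]
  refine measure_mono ?_
  rintro _ ⟨_, ⟨x, ⟨h1, h2, h3⟩, rfl⟩, rfl⟩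
  rw [flip_flip] at h2
  refine ⟨(hDA x).1 h2, ?_⟩
  rw [Set.mem_smul_set_iff_inv_smul_mem]
  convert (hDA _).1 h1 using 1
  have h4 := singleStep_smul_point h3
  rw [flip_flip] at h4
  simp [← h4, mul_smul]

/-- The return elements lie exactly on the one-parameter subgroup, so the distance is `0` whatever
the metric. -/
theorem isRecurrentAlong_of_mem_expLine (m : MetricSpace H3R) {θ : ℙ ℝ h3}
    (h : ∀ (g : H3Z) (N : ℕ), ∃ i ≥ N, g * singleStep i * g⁻¹ ≠ 1 ∧
      ((g * singleStep i * g⁻¹ : H3Z) : H3R) ∈ expLine θ) :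
    IsRecurrentAlong m heisMeasure θ := by
  intro ε hε A hA hpos
  obtain ⟨g, N, hN⟩ := exists_measure_inter_conj_pos hA hpos
  obtain ⟨i, hi, hne, hmem⟩ := h g N
  refine ⟨_, hne, _, hmem, ?_, hN i hi⟩
  rw [@dist_self _ m.toPseudoMetricSpace]
  exact hε

theorem conj_singleStep (g : H3Z) (i : ℕ) : g * singleStep i * g⁻¹ =
    H3Z.of (scale i * (direction i).1) 0
      (scale i * (direction i).2 - H3Z.cy g * (scale i * (direction i).1)) := by
  refine H3Z.coords_ext ?_ ?_ ?_ <;> simp [singleStep]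
  ring

theorem isRecurrentAlong_thetaLine (m : MetricSpace H3R) (l : ℤ) :
    IsRecurrentAlong m heisMeasure (thetaLine l) := by
  refine isRecurrentAlong_of_mem_expLine m fun g N => ?_
  -- Conjugation by `g` subtracts `cy g` from the slope, so the step is chosen with slope `l + cy
  -- g`.
  obtain ⟨i, hi, hdir⟩ := exists_direction (l + H3Z.cy g) N
  refine ⟨i, hi, fun h => ?_, ?_⟩
  · rw [conj_singleStep, hdir] at h
    have := congrArg H3Z.cx h
    simp [(scale_pos i).ne'] at this
  · obtain ⟨h, e⟩ := thetaLine_eq l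
    rw [e, mem_expLine_mk, conj_singleStep, hdir]
    refine ⟨scale i, ?_⟩
    rw [H3Z.mat_of]
    congr 1 <;> push_cast <;> ring

/-- Vertical steps are central, so conjugation leaves them unchanged. -/
theorem isRecurrentAlong_thetaInf (m : MetricSpace H3R) :
    IsRecurrentAlong m heisMeasure thetaInf := by
  refine isRecurrentAlong_of_mem_expLine m fun g N => ?_
  obtain ⟨i, hi, hdir⟩ := exists_direction_inf N
  refine ⟨i, hi, fun h => ?_, ?_⟩
  · rw [conj_singleStep, hdir] at h
    have := congrArg H3Z.cz h
    simp [(scale_pos i).ne'] at this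
  · obtain ⟨h, e⟩ := thetaInf_eq
    rw [e, mem_expLine_mk, conj_singleStep, hdir]
    refine ⟨scale i, ?_⟩
    rw [H3Z.mat_of]
    congr 1 <;> push_cast <;> ring

/-! ### Absence of recurrence along all other lines. -/

/-- The return times to the base of a tower, with their leading step. -/
theorem exists_leading_step {N : ℕ} {γ : H3Z} (hγ : γ ≠ 1) {x y : ℕ → Bool}
    (hx : x ∈ zeroFirst N) (hy : y ∈ zeroFirst N) (h : γ • point x = point y) :
    ∃ i ≥ N, ∃ k a b : ℤ, |k| = 1 ∧ |a| ≤ partialBound i ∧ |b| ≤ partialBound i ∧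
      H3Z.cx γ = scale i * (k * (direction i).1) + a ∧
      H3Z.cz γ = scale i * (k * (direction i).2) + b := by
  obtain ⟨hcy, hcx, hcz⟩ := smul_point_eq h
  have hη := abs_digit_sub_le y x
  have hη0 : ∀ i < N, (digit y - digit x) i = 0 := fun i hi => by
    simp [digit, hx i hi, hy i hi]
  generalize digit y - digit x = η at *
  have hbx := abs_xPart_le hη
  have hbz := abs_zPart_le hη
  -- Both coordinates are eventually partial sums. At the least common index the last coefficient is
  -- nonzero, since otherwise the preceding index would do; it is the leading step.
  have hex : ∃ n, H3Z.cx γ = partialSum (xPart η) n ∧ H3Z.cz γ = partialSum (zPart η) n :=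
    ((eventually_eq_partialSum hbx hcx).and (eventually_eq_partialSum hbz hcz)).exists
  classical
  obtain ⟨h1, h2⟩ := Nat.find_spec hex
  have hmin := fun n => Nat.find_min hex (m := n)
  generalize Nat.find hex = n at *
  have hzero : ∀ n ≤ N, ¬ (H3Z.cx γ = partialSum (xPart η) n ∧
      H3Z.cz γ = partialSum (zPart η) n) := by
    rintro n hn ⟨h1, h2⟩
    have h3 (a : ℕ → ℤ) (ha : ∀ i < N, a i = 0) : partialSum a n = 0 :=
      Finset.sum_eq_zero fun i hi => by
        rw [ha i ((Finset.mem_range.1 hi).trans_le hn), mul_zero]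
    rw [h3 _ fun i hi => by rw [xPart, hη0 i hi, zero_mul]] at h1
    rw [h3 _ fun i hi => by rw [zPart, hη0 i hi, zero_mul]] at h2
    exact hγ (H3Z.coords_ext (by simpa) (by simpa) (by simpa))
  have hnN : N < n := by
    by_contra! hn
    exact hzero n hn ⟨h1, h2⟩
  obtain ⟨i, rfl⟩ := Nat.exists_eq_succ_of_ne_zero (by omega : n ≠ 0)
  rw [Nat.succ_eq_add_one, partialSum_succ] at h1 h2
  refine ⟨i, by omega, η i, _, _, ?_, abs_partialSum_le hbx i, abs_partialSum_le hbz i,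
    h1.trans (add_comm _ _), h2.trans (add_comm _ _)⟩
  have hne : η i ≠ 0 := fun h0 => hmin i (by omega) ⟨by simpa [xPart, h0] using h1,
    by simpa [zPart, h0] using h2⟩
  have h3 := hη i
  have h4 := abs_pos.2 hne
  omega

theorem exists_points_of_pos {N : ℕ} {γ : H3Z} (h : 0 < heisMeasure (base N ∩ γ • base N)) :
    ∃ x ∈ zeroFirst N, ∃ y ∈ zeroFirst N, γ • point x = point y := by
  obtain ⟨_, ⟨y, hy, rfl⟩, _, ⟨x, hx, rfl⟩, hxy⟩ := nonempty_of_measure_ne_zero h.ne'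
  exact ⟨x, hx, y, hy, hxy⟩

/-- The functional `z - t x` vanishes on `exp θ_t`, so it is below `1` in absolute value on elements
close to it. On a return to a late base the leading step makes it at least `1`, as every direction
stays a fixed distance `d` away from its kernel. -/
theorem not_isRecurrentAlong_thetaLine {m : MetricSpace H3R} (hm : IsRightInvariantMetric m)
    {t : ℝ} (ht : ∀ l : ℤ, t ≠ l) : ¬ IsRecurrentAlong m heisMeasure (thetaLine t) := by
  intro hrec
  obtain ⟨d, hd, hdir⟩ : ∃ d > 0, ∀ i, d ≤ |((direction i).2 : ℝ) - t * (direction i).1| := by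
    -- The value `1` comes from the vertical direction, and the distance from `t` to the nearest
    -- integer from the directions `(1, l)`.
    refine ⟨min 1 |t - round t|, lt_min one_pos (abs_pos.2 (sub_ne_zero.2 (ht _))), fun i => ?_⟩
    rcases direction_cases i with h | ⟨l, h⟩
    · simp [h]
    · rw [h, Int.cast_one, mul_one]
      exact (min_le_right _ _).trans ((round_le t l).trans (abs_sub_comm _ _).le)
  -- For `i ≥ N` this makes the error `(1 + |t|) * partialBound i` at most half of the main term
  -- `scale i * d`.
  obtain ⟨N, hN⟩ := exists_nat_ge ((1 + |t|) / d)
  have ht0 := abs_nonneg t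
  obtain ⟨ε, hε, hclose⟩ := hm.exists_entries_lt (η := 1 / (1 + |t|)) (by positivity)
  obtain ⟨γ, hγ, g, hg, hdist, hpos⟩ := hrec ε hε (base N) (measurableSet_base N)
    (heisMeasure_base_pos N)
  obtain ⟨x, hx, y, hy, hxy⟩ := exists_points_of_pos hpos
  obtain ⟨i, hi, k, a, b, hk, ha, hb, hcx, hcz⟩ := exists_leading_step hγ hx hy hxy
  obtain ⟨h, e⟩ := thetaLine_eq t
  rw [e, mem_expLine_mk] at hg
  obtain ⟨s, hs⟩ := hg
  obtain ⟨p, q, r, hp, hq, hr, hmat⟩ := hclose _ _ hdist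
  rw [hs, upper_mul, H3Z.mat_eq, one_mul] at hmat
  obtain ⟨h1, h2, h3⟩ := H3Z.upper_one_inj hmat
  have hup : |(H3Z.cz γ : ℝ) - t * H3Z.cx γ| < 1 := by
    have h4 : (H3Z.cz γ : ℝ) - t * H3Z.cx γ = r - t * p := by
      rw [h1, h3]
      ring
    rw [h4]
    calc |r - t * p| ≤ |r| + |t * p| := abs_sub _ _
      _ = |r| + |t| * |p| := by rw [abs_mul]
      _ < 1 / (1 + |t|) + |t| * (1 / (1 + |t|)) :=
        add_lt_add_of_lt_of_le hr (mul_le_mul_of_nonneg_left hp.le ht0)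
      _ = 1 := by field_simp
  have hlow : 1 ≤ |(H3Z.cz γ : ℝ) - t * H3Z.cx γ| := by
    have h4 : (H3Z.cz γ : ℝ) - t * H3Z.cx γ =
        scale i * (k * ((direction i).2 - t * (direction i).1)) - (t * a - b) := by
      rw [hcx, hcz]
      push_cast
      ring
    have hk' : |(k : ℝ)| = 1 := by exact_mod_cast hk
    have ha' : |(a : ℝ)| ≤ partialBound i := by exact_mod_cast ha
    have hb' : |(b : ℝ)| ≤ partialBound i := by exact_mod_cast hb
    have hS : (0 : ℝ) < scale i := by exact_mod_cast scale_pos i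
    have hS2 : (scale i : ℝ) = 2 * halfScale i := by exact_mod_cast scale_eq i
    have hP : ((i : ℝ) + 1) * partialBound i ≤ halfScale i := by
      exact_mod_cast mul_partialBound_le i
    have hP0 : (0 : ℝ) ≤ partialBound i := by exact_mod_cast partialBound_nonneg i
    have hi' : (i : ℝ) < halfScale i := by exact_mod_cast lt_halfScale i
    have hNi : 1 + |t| ≤ i * d := by
      rw [div_le_iff₀ hd] at hN
      have : (N : ℝ) ≤ i := by exact_mod_cast hi
      nlinarith
    have h5 : (scale i : ℝ) * d ≤
        |(scale i : ℝ) * (k * ((direction i).2 - t * (direction i).1))| := by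
      rw [abs_mul, abs_mul, hk', one_mul, abs_of_pos hS]
      exact mul_le_mul_of_nonneg_left (hdir i) hS.le
    have h6 : |t * a - b| ≤ (1 + |t|) * partialBound i := by
      calc |t * a - b| ≤ |t * a| + |(b : ℝ)| := abs_sub _ _
        _ = |t| * |(a : ℝ)| + |(b : ℝ)| := by rw [abs_mul]
        _ ≤ |t| * partialBound i + partialBound i :=
          add_le_add (mul_le_mul_of_nonneg_left ha' ht0) hb'
        _ = _ := by ring
    have h7 : (1 + |t|) * partialBound i ≤ d * halfScale i := by
      calc (1 + |t|) * partialBound i ≤ i * d * partialBound i :=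
            mul_le_mul_of_nonneg_right hNi hP0
        _ = d * (i * partialBound i) := by ring
        _ ≤ d * halfScale i := mul_le_mul_of_nonneg_left (by linarith) hd.le
    have h8 : 1 ≤ d * halfScale i := by nlinarith
    rw [h4]
    have := abs_sub_abs_le_abs_sub
      ((scale i : ℝ) * (k * ((direction i).2 - t * (direction i).1))) (t * a - b)
    rw [hS2] at h5 this ⊢
    linarith
  exact absurd hup (not_lt.2 hlow)

theorem int_eq_zero_of_abs_lt_one {k : ℤ} (h : |(k : ℝ)| < 1) : k = 0 := by
  have : |k| < 1 := by exact_mod_cast h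
  exact Int.abs_lt_one_iff.1 this

/-- Along such a line the parameter equals the middle coordinate, which is `0` for any return to the
points. So the parameter is small, hence `γ` is close to `1`, and integrality forces `γ = 1`. -/
theorem not_isRecurrentAlong_transverse {m : MetricSpace H3R} (hm : IsRightInvariantMetric m)
    {a c : ℝ} (h : h3.of a 1 c ≠ 0) :
    ¬ IsRecurrentAlong m heisMeasure (Projectivization.mk ℝ (h3.of a 1 c) h) := by
  intro hrec
  have ha := abs_nonneg a
  have hc := abs_nonneg c
  obtain ⟨η, hη, hη1, hη2⟩ : ∃ η : ℝ, 0 < η ∧ η < 1 ∧ η * (3 + |a| + |c|) = 1 := by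
    refine ⟨1 / (3 + |a| + |c|), by positivity, ?_, by field_simp⟩
    rw [div_lt_one (by positivity)]
    linarith
  obtain ⟨ε, hε, hclose⟩ := hm.exists_entries_lt hη
  -- With no digit prescribed, `base 0` is the whole of `points`.
  obtain ⟨γ, hγ, g, hg, hdist, hpos⟩ := hrec ε hε (base 0) (measurableSet_base 0)
    (heisMeasure_base_pos 0)
  obtain ⟨x, -, y, -, hxy⟩ := exists_points_of_pos hpos
  have hcy := (smul_point_eq hxy).1
  rw [mem_expLine_mk] at hg
  obtain ⟨s, hs⟩ := hg
  obtain ⟨p, q, r, hp, hq, hr, hmat⟩ := hclose _ _ hdist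
  rw [hs, upper_mul, H3Z.mat_eq, one_mul] at hmat
  obtain ⟨h1, h2, h3⟩ := H3Z.upper_one_inj hmat
  rw [hcy, Int.cast_zero] at h2
  have hs' : |s| < η := by
    have : s = -q := by linarith
    rwa [this, abs_neg]
  have hs0 := abs_nonneg s
  have hx0 : H3Z.cx γ = 0 := by
    apply int_eq_zero_of_abs_lt_one
    have : (H3Z.cx γ : ℝ) = s * a + p := by rw [h1]; ring
    rw [this]
    calc |s * a + p| ≤ |s * a| + |p| := abs_add_le _ _
      _ = |s| * |a| + |p| := by rw [abs_mul]
      _ < 1 := by nlinarith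
  have hz0 : H3Z.cz γ = 0 := by
    apply int_eq_zero_of_abs_lt_one
    have : (H3Z.cz γ : ℝ) = s * c + (s * s * a / 2 + p * s) + r := by rw [h3]; ring
    rw [this]
    have e1 : |s * c| ≤ η * |c| := by
      rw [abs_mul]
      exact mul_le_mul_of_nonneg_right hs'.le hc
    have e2 : |s * s * a / 2| ≤ η * |a| := by
      rw [abs_div, abs_mul, abs_mul, abs_of_pos (zero_lt_two' ℝ)]
      have : |s| * |s| ≤ η := by nlinarith
      have := mul_le_mul_of_nonneg_right this ha
      have : 0 ≤ |s| * |s| * |a| := by positivity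
      linarith
    have e3 : |p * s| ≤ η := by
      rw [abs_mul]
      nlinarith [abs_nonneg p]
    have e4 := abs_add_le (s * c + (s * s * a / 2 + p * s)) r
    have e5 := abs_add_le (s * c) (s * s * a / 2 + p * s)
    have e6 := abs_add_le (s * s * a / 2) (p * s)
    nlinarith
  exact hγ (H3Z.coords_ext (by simpa) (by simpa) (by simpa))

/-! ### The recurrent and the evenly recurrent lines. -/

theorem recurrentLines_heisMeasure {m : MetricSpace H3R} (hm : IsRightInvariantMetric m) :
    recurrentLines m heisMeasure = (Set.range fun l : ℤ => thetaLine l) ∪ {thetaInf} := by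
  ext θ
  constructor
  · intro hθ
    rcases line_cases θ with ⟨a, c, h, rfl⟩ | ⟨t, rfl⟩ | rfl
    · exact absurd hθ (not_isRecurrentAlong_transverse hm h)
    · by_cases ht : ∃ l : ℤ, t = l
      · obtain ⟨l, rfl⟩ := ht
        exact .inl ⟨l, rfl⟩
      · push Not at ht
        exact absurd hθ (not_isRecurrentAlong_thetaLine hm ht)
    · exact .inr rfl
  · rintro (⟨l, rfl⟩ | rfl)
    · exact isRecurrentAlong_thetaLine m l
    · exact isRecurrentAlong_thetaInf m

theorem not_isEvenlyRecurrentAlong_thetaLine {m : MetricSpace H3R}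
    (hm : IsRightInvariantMetric m) (t : ℝ) :
    ¬ IsEvenlyRecurrentAlong m heisMeasure (thetaLine t) := by
  intro h
  -- Any nonintegral slope in the orbit would serve.
  refine not_isRecurrentAlong_thetaLine hm (t := 1 / 2) (fun l hl => ?_)
    (h _ (thetaLine_mem_orbit t (1 / 2)))
  have h2 : (2 * l : ℝ) = 1 := by rw [← hl]; norm_num
  have h3 : 2 * l = 1 := by exact_mod_cast h2
  omega

theorem evenlyRecurrentLines_heisMeasure {m : MetricSpace H3R} (hm : IsRightInvariantMetric m) :
    evenlyRecurrentLines m heisMeasure = {thetaInf} := by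
  ext θ
  constructor
  · intro hθ
    have hrec : θ ∈ recurrentLines m heisMeasure := hθ θ (MulAction.mem_orbit_self θ)
    rw [recurrentLines_heisMeasure hm] at hrec
    rcases hrec with ⟨l, rfl⟩ | h
    · exact absurd hθ (not_isEvenlyRecurrentAlong_thetaLine hm l)
    · exact h
  · rintro rfl _ ⟨g, rfl⟩
    dsimp only
    rw [smul_thetaInf]
    exact isRecurrentAlong_thetaInf m

end Heisenberg
end

theorem theorem6p2 :
    ∃ (X : Type) (_ : MeasurableSpace X) (_ : StandardBorelSpace X) (_ : MulAction H3Z X)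
      (μ : Measure X),
      SigmaFinite μ ∧ μ Set.univ = ∞ ∧
      (∀ γ : H3Z, MeasurePreserving (fun x : X => γ • x) μ μ) ∧
      (∀ γ : H3Z, γ ≠ 1 → ∀ x : X, γ • x ≠ x) ∧
      IsRankOne H3Z μ ∧
      ∀ m : MetricSpace H3R, IsRightInvariantMetric m →
        recurrentLines m μ = (Set.range fun l : ℤ => thetaLine l) ∪ {thetaInf} ∧
        evenlyRecurrentLines m μ = {thetaInf} ∧
        evenlyRecurrentLines m μ ≠ recurrentLines m μ := by
  refine ⟨Space, inferInstance, inferInstance, inferInstance, heisMeasure, inferInstance,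
    heisMeasure_univ, measurePreserving_smul, fun γ hγ => Space.smul_ne hγ,
    isRankOne_heisMeasure, fun m hm => ?_⟩
  refine ⟨recurrentLines_heisMeasure hm, evenlyRecurrentLines_heisMeasure hm, fun h => ?_⟩
  have h0 : thetaLine (0 : ℤ) ∈ recurrentLines m heisMeasure := isRecurrentAlong_thetaLine m 0
  rw [← h] at h0
  exact not_isEvenlyRecurrentAlong_thetaLine hm _ h0
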